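/- Let $K$ be a perfect field of characteristic $p>0$, $P_n=K[x_1,\dots,x_n]$, let $I=(f_1,\dots,f_m)$ be a prime but not maximal ideal of $P_n$, and let $A=S^{-1}(P_n/I)$ be a localization of $P_n/I$ at a multiplicatively closed subset $S$ such that $A$ is a domain, with field of fractions $Q$. We write $x_l$ also for the image of $x_l$, and $\overline{g}$ for the image of $g\in P_n$. Let $\overline J=\big(\overline{\partial f_a/\partial x_b}\big)\in M_{m,n}(A)$ be the Jacobi matrix and $r$ its rank over $Q$. For $\mathbf i=(i_1<\dots<i_r)$ and $\mathbf j=(j_1<\dots<j_r)$ with $1\le i_a\le m$ and $1\le j_b\le n$, let $\Delta(\mathbf i,\mathbf j)=\det(\overline J_{i_a,j_b})$; call $\mathbf i$ (resp. $\mathbf j$) non-singular if $\Delta(\mathbf i,\mathbf j')\ne0$ for some $\mathbf j'$ (resp. $\Delta(\mathbf i',\mathbf j)\neq 0$ for some $\mathbf i'$). Fix non-singular $\mathbf i$ and $\mathbf j$, put $\Delta=\Delta(\mathbf i,\mathbf j)$ and $\{j_{r+1},\dots,j_n\}=\{1,\dots,n\}\setminus\{j_1,\dots,j_r\}$, and let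 $A_\Delta$ be the localization of $A$ at the powers of $\Delta$. The ring $\mathcal D(B)=\bigcup_{i\ge 0}\mathcal D(B)_i\subseteq \mathrm{End}_K(B)$ of $K$-linear differential operators on a commutative $K$-algebra $B$ is defined by $\mathcal D(B)_0=B$ (acting by multiplication) and $\mathcal D(B)_i=\{u\in\mathrm{End}_K(B): [b,u]\in \mathcal D(B)_{i-1}\text{ for all } b\in B\}$ for $i\geq 1$. A higher derivation of $B$ over $K$ is a sequence $(\delta^{[k]})_{k\ge0}$ of $K$-linear maps $B\to B$ with $\delta^{[0]}=\mathrm{id}$ and $\delta^{[k]}(ab)=\sum_{s+t=k}\delta^{[s]}(a)\delta^{[t]}(b)$ for all $a,b\in B$; it is iterative if $\delta^{[k]}\delta^{[l]}=\binom{k+l}{k}\delta^{[k+l]}$ for all $k,l\ge 0$. For $\nu=r+1,\dots,n$ let $\partial_{\mathbf i;\mathbf j,j_\nu}$ be the derivation that sends $\overline g$, $g\in P_n$, to the determinant of the $(r+1)\times(r+1)$ matrix with columns indexed by $j_1,\dots,j_r,j_\nu$ whose first $r$ rows are the rows $i_1,\dots,i_r$ of $\overline J$ and whose last row consists of the elements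 $\overline{\partial g/\partial x_{j_1}},\dots,\overline{\partial g/\partial x_{j_r}},\overline{\partial g/\partial x_{j_\nu}}$. Then for each $\nu=r+1,\dots,n$ there is a unique iterative higher derivation $(\delta^{[k]}_{\mathbf i;\mathbf j,j_\nu})_{k\ge0}$ of $A_\Delta$ over $K$ such that $\delta^{[1]}_{\mathbf i;\mathbf j,j_\nu}=\Delta^{-1}\partial_{\mathbf i;\mathbf j,j_\nu}$ and $\delta^{[k]}_{\mathbf i;\mathbf j,j_\nu}(x_{j_\mu})=0$ for all $k\ge2$ and $\mu=r+1,\dots,n$ (i.e. which restricts to the divided powers $\frac{1}{k!}\frac{\partial^k}{\partial x_{j_\nu}^k}$ on $K[x_{j_{r+1}},\dots,x_{j_n}]$). The $K$-algebra $\mathcal D(A_\Delta)$ is generated by the algebra $A_\Delta$ and the elements $\delta^{[k]}_{\mathbf i;\mathbf j,j_\nu}$, $\nu=r+1,\dots,n$, $k\ge0$, and the following are defining relations (over $A_\Delta$, with $\delta^{[0]}_{\mathbf i;\mathbf j,j_\nu}=1$): for all $\nu,\mu=r+1,\dots,n$ and $k,l\ge1$, $$[\delta^{[k]}_{\mathbf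 i;\mathbf j,j_\nu},\delta^{[l]}_{\mathbf i;\mathbf j,j_\mu}]=0,\qquad \delta^{[k]}_{\mathbf i;\mathbf j,j_\nu}\delta^{[l]}_{\mathbf i;\mathbf j,j_\nu}=\binom{k+l}{k}\delta^{[k+l]}_{\mathbf i;\mathbf j,j_\nu},\qquad [\delta^{[k]}_{\mathbf i;\mathbf j,j_\nu},x_{j_\mu}]=\begin{cases}\delta^{[k-1]}_{\mathbf i;\mathbf j,j_\nu}&\text{if }\nu=\mu,\\ 0&\text{if }\nu\ne\mu,\end{cases}$$ and, for all $\nu=r+1,\dots,n$, $s=1,\dots,r$ and $k\ge1$, $$[\delta^{[k]}_{\mathbf i;\mathbf j,j_\nu},x_{j_s}]=\sum_{t=1}^k\delta^{[t]}_{\mathbf i;\mathbf j,j_\nu}(x_{j_s})\,\delta^{[k-t]}_{\mathbf i;\mathbf j,j_\nu},$$ where $\delta^{[t]}_{\mathbf i;\mathbf j,j_\nu}(x_{j_s})\in A_\Delta$ is the value of the operator $\delta^{[t]}_{\mathbf i;\mathbf j,j_\nu}$ at $x_{j_s}$, which satisfies $t!\,\delta^{[t]}_{\mathbf i;\mathbf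 j,j_\nu}(x_{j_s})=(\Delta^{-1}\partial_{\mathbf i;\mathbf j,j_\nu})^t(x_{j_s})$. -/

import Mathlib

namespace DiffOps

/-! ### Differential operators -/

section DifferentialOperators

variable (K B : Type*) [CommRing K] [CommRing B] [Algebra K B]

/-- The order filtration of the ring of `K`-linear differential operators on `B`: order `0` means
multiplication by an element of `B`, and `u` has order at most `i + 1` when every commutator
`[b, u]`, with `b` an element of `B`, has order at most `i`. -/
def HasOrderLE : ℕ → Module.End K B → Prop
  | 0, u => ∃ b : B, u = Algebra.lmul K B b
  | i + 1, u => ∀ b : B, HasOrderLE i (Algebra.lmul K B b * u - u * Algebra.lmul K B b)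

variable {K B}

theorem HasOrderLE.zero_mem (i : ℕ) : HasOrderLE K B i 0 := by
  induction i with
  | zero => exact ⟨0, by simp⟩
  | succ i ih => intro b; simpa using ih

theorem lmul_comm_sub (a b : B) :
    Algebra.lmul K B b * Algebra.lmul K B a - Algebra.lmul K B a * Algebra.lmul K B b = 0 := by
  rw [← map_mul, ← map_mul, mul_comm, sub_self]

theorem HasOrderLE.lmul (i : ℕ) (a : B) : HasOrderLE K B i (Algebra.lmul K B a) := by
  cases i with
  | zero => exact ⟨a, rfl⟩
  | succ i => intro b; rw [lmul_comm_sub]; exact HasOrderLE.zero_mem i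

theorem HasOrderLE.succ {i : ℕ} {u : Module.End K B} (h : HasOrderLE K B i u) :
    HasOrderLE K B (i + 1) u := by
  induction i generalizing u with
  | zero => obtain ⟨a, rfl⟩ := h; exact HasOrderLE.lmul 1 a
  | succ i ih => intro b; exact ih (h b)

theorem HasOrderLE.mono {i j : ℕ} (hij : i ≤ j) {u : Module.End K B} (h : HasOrderLE K B i u) :
    HasOrderLE K B j u := by
  induction hij with
  | refl => exact h
  | step _ ih => exact ih.succ

theorem HasOrderLE.add {i : ℕ} {u v : Module.End K B} (hu : HasOrderLE K B i u)
    (hv : HasOrderLE K B i v) : HasOrderLE K B i (u + v) := by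
  induction i generalizing u v with
  | zero =>
    obtain ⟨a, rfl⟩ := hu
    obtain ⟨b, rfl⟩ := hv
    exact ⟨a + b, (map_add _ a b).symm⟩
  | succ i ih =>
    intro b
    have h := ih (hu b) (hv b)
    convert h using 1
    noncomm_ring

theorem HasOrderLE.mul_aux (n : ℕ) : ∀ (i j : ℕ), i + j = n → ∀ {u v : Module.End K B},
    HasOrderLE K B i u → HasOrderLE K B j v → HasOrderLE K B n (u * v) := by
  induction n with
  | zero =>
    intro i j hij u v hu hv
    obtain ⟨rfl, rfl⟩ : i = 0 ∧ j = 0 := by omega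
    obtain ⟨a, rfl⟩ := hu
    obtain ⟨b, rfl⟩ := hv
    exact ⟨a * b, (map_mul _ a b).symm⟩
  | succ n ih =>
    intro i j hij u v hu hv b
    have key : Algebra.lmul K B b * (u * v) - u * v * Algebra.lmul K B b
        = (Algebra.lmul K B b * u - u * Algebra.lmul K B b) * v
          + u * (Algebra.lmul K B b * v - v * Algebra.lmul K B b) := by
      rw [sub_mul, mul_sub, mul_assoc, mul_assoc, mul_assoc]; abel
    rw [key]
    refine HasOrderLE.add ?_ ?_
    · cases i with
      | zero =>
        obtain ⟨a, rfl⟩ := hu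
        rw [lmul_comm_sub, zero_mul]
        exact HasOrderLE.zero_mem n
      | succ i => exact ih i j (by omega) (hu b) hv
    · cases j with
      | zero =>
        obtain ⟨a, rfl⟩ := hv
        rw [lmul_comm_sub, mul_zero]
        exact HasOrderLE.zero_mem n
      | succ j => exact ih i j (by omega) hu (hv b)

variable (K B)

/-- The ring `D(B)` of `K`-linear differential operators on `B`, a subalgebra of `End_K(B)`. -/
def diffOps : Subalgebra K (Module.End K B) where
  carrier := {u | ∃ i : ℕ, HasOrderLE K B i u}
  mul_mem' := by
    rintro u v ⟨i, hu⟩ ⟨j, hv⟩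
    exact ⟨i + j, HasOrderLE.mul_aux (i + j) i j rfl hu hv⟩
  add_mem' := by
    rintro u v ⟨i, hu⟩ ⟨j, hv⟩
    exact ⟨max i j, (hu.mono (le_max_left i j)).add (hv.mono (le_max_right i j))⟩
  algebraMap_mem' := by
    intro c
    refine ⟨0, algebraMap K B c, ?_⟩
    rw [AlgHom.commutes]

end DifferentialOperators

/-! ### Higher derivations -/

section HigherDerivations

variable {K B : Type*} [CommRing K] [CommRing B] [Algebra K B]

/-- Higher (Hasse–Schmidt) derivations of `B` over `K`. -/
structure IsHigherDerivation (d : ℕ → Module.End K B) : Prop where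
  zero : d 0 = 1
  leibniz : ∀ (k : ℕ) (x y : B),
    d k (x * y) = ∑ q ∈ Finset.HasAntidiagonal.antidiagonal k, d q.1 x * d q.2 y

/-- Iterative higher derivations. -/
structure IsIterative (d : ℕ → Module.End K B) : Prop extends IsHigherDerivation d where
  iterate : ∀ k l : ℕ, d k * d l = (k + l).choose k • d (k + l)

end HigherDerivations

/-! ### Jacobi matrices, minors and the derivations they define -/

section Jacobi

variable {K B : Type*} [CommRing K] [CommRing B] {m n r : ℕ}

/-- The Jacobi matrix of `f₁, …, f_m`, with entries mapped to `B`. -/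
noncomputable def jacobiMatrix (φ : MvPolynomial (Fin n) K →+* B)
    (f : Fin m → MvPolynomial (Fin n) K) : Matrix (Fin m) (Fin n) B :=
  Matrix.of fun a b => φ (MvPolynomial.pderiv b (f a))

/-- The minor `Δ(i, j)` of the Jacobi matrix. -/
noncomputable def jacobiMinor (φ : MvPolynomial (Fin n) K →+* B)
    (f : Fin m → MvPolynomial (Fin n) K) (i : Fin r ↪o Fin m) (j : Fin r ↪o Fin n) : B :=
  ((jacobiMatrix φ f).submatrix i j).det

/-- The row tuple `i` is non-singular: `Δ(i, j') ≠ 0` for some `j'`. -/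
def NonsingularRows (φ : MvPolynomial (Fin n) K →+* B)
    (f : Fin m → MvPolynomial (Fin n) K) (i : Fin r ↪o Fin m) : Prop :=
  ∃ j' : Fin r ↪o Fin n, jacobiMinor φ f i j' ≠ 0

/-- The column tuple `j` is non-singular: `Δ(i', j) ≠ 0` for some `i'`. -/
def NonsingularCols (φ : MvPolynomial (Fin n) K →+* B)
    (f : Fin m → MvPolynomial (Fin n) K) (j : Fin r ↪o Fin n) : Prop :=
  ∃ i' : Fin r ↪o Fin m, jacobiMinor φ f i' j ≠ 0

/-- The indices `j_{r+1}, …, j_n`, i.e. the complement of `{j_1, …, j_r}`. -/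
abbrev FreeIndex (j : Fin r ↪o Fin n) : Type := {l : Fin n // l ∉ Set.range j}

/-- The value at a polynomial `g` of the derivation `∂_{i; j, l}`: the determinant of the square
matrix of size `r + 1` with columns `j_1, …, j_r, l`, whose first `r` rows are the rows
`i_1, …, i_r` of the Jacobi matrix and whose last row holds the partial derivatives of `g`. -/
noncomputable def jacobiDerivation (φ : MvPolynomial (Fin n) K →+* B)
    (f : Fin m → MvPolynomial (Fin n) K) (i : Fin r ↪o Fin m) (j : Fin r ↪o Fin n) (l : Fin n)
    (g : MvPolynomial (Fin n) K) : B :=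
  (Matrix.of fun a b : Fin (r + 1) =>
    φ (MvPolynomial.pderiv ((Fin.snoc j l : Fin (r + 1) → Fin n) b)
      ((Fin.snoc (fun a' : Fin r => f (i a')) g :
        Fin (r + 1) → MvPolynomial (Fin n) K) a))).det

/-- `d` is the iterative higher derivation of `B` attached to `Δ(i, j)⁻¹ ∂_{i; j, ν}`: its first
term is that derivation, and on the polynomial subalgebra in the variables `x_μ` with `μ` outside
`{j_1, …, j_r}` it is the sequence of divided powers of `∂/∂x_ν`, that is, `x_ν ↦ x_ν + t` and
`x_μ ↦ x_μ` for `μ ≠ ν`; given the first term this says that all terms of order at least `2` kill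
these variables. (Without the last condition `d` would not be unique: on `K[x]`, in
characteristic `p`, also `x ↦ x + t + t ^ p` is iterative with first term `d/dx`.) -/
structure IsAttached [Algebra K B] (φ : MvPolynomial (Fin n) K →+* B)
    (f : Fin m → MvPolynomial (Fin n) K) (i : Fin r ↪o Fin m) (j : Fin r ↪o Fin n)
    (ν : FreeIndex j) (d : ℕ → Module.End K B) : Prop where
  iterative : IsIterative d
  first : ∀ g : MvPolynomial (Fin n) K,
    jacobiMinor φ f i j * d 1 (φ g) = jacobiDerivation φ f i j ν g
  higher : ∀ (μ : FreeIndex j) (k : ℕ), 2 ≤ k → d k (φ (MvPolynomial.X μ)) = 0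

end Jacobi

/-! ### The algebra given by generators and relations -/

section Presentation

variable (K : Type*) {B N M : Type*} [CommRing K] [CommRing B] [Algebra K B]

/-- The generator belonging to an element of the coefficient algebra `B`. -/
def coeffGen (N : Type*) (a : B) : FreeAlgebra K (B ⊕ N × ℕ) :=
  FreeAlgebra.ι K (Sum.inl a)

/-- The generator `δ_ν^{[k]}`. -/
def deltaGen (B : Type*) (ν : N) (k : ℕ) : FreeAlgebra K (B ⊕ N × ℕ) :=
  FreeAlgebra.ι K (Sum.inr (ν, k))

variable {K}

/-- The relations. The first three say that the generators of the first kind form a copy of the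
algebra `B`. Here `x ν` and `y s` are elements of `B`, and the coefficients in the last relation
are the values at `y s` of given operators `δ ν t`. -/
inductive Rel [DecidableEq N] (x : N → B) (y : M → B) (δ : N → ℕ → Module.End K B) :
    FreeAlgebra K (B ⊕ N × ℕ) → FreeAlgebra K (B ⊕ N × ℕ) → Prop
  | coeff_add (a b : B) :
      Rel x y δ (coeffGen K N (a + b)) (coeffGen K N a + coeffGen K N b)
  | coeff_mul (a b : B) :
      Rel x y δ (coeffGen K N (a * b)) (coeffGen K N a * coeffGen K N b)
  | coeff_scalar (c : K) :
      Rel x y δ (coeffGen K N (algebraMap K B c)) (algebraMap K _ c)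
  | delta_zero (ν : N) :
      Rel x y δ (deltaGen K B ν 0) 1
  | delta_comm (ν μ : N) (k l : ℕ) (hk : 1 ≤ k) (hl : 1 ≤ l) :
      Rel x y δ (deltaGen K B ν k * deltaGen K B μ l - deltaGen K B μ l * deltaGen K B ν k) 0
  | delta_iterate (ν : N) (k l : ℕ) (hk : 1 ≤ k) (hl : 1 ≤ l) :
      Rel x y δ (deltaGen K B ν k * deltaGen K B ν l)
        ((k + l).choose k • deltaGen K B ν (k + l))
  | delta_x (ν μ : N) (k : ℕ) (hk : 1 ≤ k) :
      Rel x y δ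
        (deltaGen K B ν k * coeffGen K N (x μ) - coeffGen K N (x μ) * deltaGen K B ν k)
        (if ν = μ then deltaGen K B ν (k - 1) else 0)
  | delta_y (ν : N) (s : M) (k : ℕ) (hk : 1 ≤ k) :
      Rel x y δ
        (deltaGen K B ν k * coeffGen K N (y s) - coeffGen K N (y s) * deltaGen K B ν k)
        (∑ t ∈ Finset.Icc 1 k, coeffGen K N (δ ν t (y s)) * deltaGen K B ν (k - t))

/-- The `K`-algebra generated by `B` and the symbols `δ_ν^{[k]}` with `Rel` as defining
relations. -/
abbrev Presented [DecidableEq N] (x : N → B) (y : M → B) (δ : N → ℕ → Module.End K B) : Type _ :=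
  RingQuot (Rel x y δ)

end Presentation

/-- The homomorphism `P_n → P_n / I → A`. -/
noncomputable def coordHom {K : Type*} [CommRing K] {n : ℕ}
    (I : Ideal (MvPolynomial (Fin n) K)) (A : Type*)
    [CommRing A] [Algebra (MvPolynomial (Fin n) K ⧸ I) A] : MvPolynomial (Fin n) K →+* A :=
  (algebraMap (MvPolynomial (Fin n) K ⧸ I) A).comp (Ideal.Quotient.mk I)

end DiffOps

open DiffOps

/-! Write `B` for `AΔ`, and call the `x_μ` with `μ` outside `j` the free coordinates. As `Δ` is a
unit of `B`, differentiating `f_a = 0` and inverting the minor shows that a derivation is determined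
by its values at the free coordinates (`derivation_eq_zero`, passed on as `hx`).

The theory of operators rests on `hx`. An operator `u` that commutes with the free coordinates is a
multiplication: by induction on the order its commutators are multiplications, so `b ↦ b * u 1 - u
b` is a derivation killing the free coordinates. Hence an operator of order at most `k` is
determined by its values at monomials of degree at most `k` in the free coordinates
(`HasOrderLE.eq_zero`). On these `δ^{[k]}` acts by binomial coefficients, so uniqueness, commutation
and iterativity become binomial identities. The products `δ^α` are triangular against the monomials
`x^β`, and so form a basis of `D(B)` as a left `B`-module.

For the presentation, the elements of `B` past which the symbols `δ^{[k]}` can be moved form a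
subalgebra closed under inverses. It contains all coordinates, hence is `B`. So the elements `b δ^α`
span the presented algebra; they go to the basis elements of `D(B)`, and the map is bijective.

For existence, dividing powers of `δ^{[1]}` by factorials is impossible in characteristic `p`.
Instead let `Q` be the fraction field of `B`. Since `K` is perfect, `Q` is formally smooth over `K`,
and dual derivations make it formally étale over the polynomial ring in the free coordinates.
Therefore `x_ν ↦ x_ν + t` extends to `Q → Q⟦t⟧`. Comparing coefficients of `t^k` in the images of
the `f_a` gives linear systems with invertible matrix, so the coefficients stay in `B`
(`coeff_mem_range`). -/

namespace DiffOps

open PowerSeries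

/-! ### Higher derivations as ring homomorphisms into power series -/

section HigherDerivation

variable {K B : Type*} [CommRing K] [CommRing B] [Algebra K B]

/-- The generating series `b ↦ ∑ d k b t ^ k` of a higher derivation. -/
noncomputable def IsHigherDerivation.series {d : ℕ → Module.End K B} (hd : IsHigherDerivation d) :
    B →+* B⟦X⟧ where
  toFun b := PowerSeries.mk fun k => d k b
  map_mul' a b := by
    ext k
    simp [coeff_mul, hd.leibniz]
  map_add' a b := by
    ext k
    simp
  map_zero' := by
    ext k
    simp
  map_one' := by
    -- The image of `1` is idempotent with constant term `1`; an idempotent unit is `1`.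
    have hu : IsUnit (PowerSeries.mk fun k => d k (1 : B)) := by
      rw [isUnit_iff_constantCoeff, ← coeff_zero_eq_constantCoeff_apply, coeff_mk, hd.zero]
      exact isUnit_one
    refine hu.mul_left_cancel ?_
    rw [mul_one]
    ext k
    conv_rhs => rw [coeff_mk, ← one_mul (1 : B), hd.leibniz]
    simp [coeff_mul]

@[simp]
theorem IsHigherDerivation.coeff_series {d : ℕ → Module.End K B} (hd : IsHigherDerivation d)
    (k : ℕ) (b : B) : coeff k (hd.series b) = d k b := by
  simp [IsHigherDerivation.series]

theorem lmul_eq_mul (a b : B) : Algebra.lmul K B a b = a * b := rfl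

theorem IsHigherDerivation.mul_lmul {d : ℕ → Module.End K B} (hd : IsHigherDerivation d)
    (k : ℕ) (b : B) : d k * Algebra.lmul K B b =
      ∑ q ∈ Finset.HasAntidiagonal.antidiagonal k, Algebra.lmul K B (d q.1 b) * d q.2 := by
  ext y
  simp [hd.leibniz]

theorem HasOrderLE.neg {i : ℕ} {u : Module.End K B} (hu : HasOrderLE K B i u) :
    HasOrderLE K B i (-u) := by
  have := HasOrderLE.mul_aux i 0 i (by omega) (HasOrderLE.lmul 0 (-1 : B)) hu
  convert this using 1
  ext y
  simp

theorem HasOrderLE.sub {i : ℕ} {u v : Module.End K B} (hu : HasOrderLE K B i u)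
    (hv : HasOrderLE K B i v) : HasOrderLE K B i (u - v) := by
  rw [sub_eq_add_neg]
  exact hu.add hv.neg

theorem HasOrderLE.sum {ι : Type*} {i : ℕ} (s : Finset ι) {u : ι → Module.End K B}
    (hu : ∀ a ∈ s, HasOrderLE K B i (u a)) : HasOrderLE K B i (∑ a ∈ s, u a) :=
  Finset.sum_induction u (HasOrderLE K B i) (fun _ _ h h' => h.add h') (HasOrderLE.zero_mem i) hu

theorem HasOrderLE.lmul_mul {i : ℕ} {u : Module.End K B} (hu : HasOrderLE K B i u) (b : B) :
    HasOrderLE K B i (Algebra.lmul K B b * u) :=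
  HasOrderLE.mul_aux i 0 i (by omega) (HasOrderLE.lmul 0 b) hu

/-- In the commutator of `d k` with `b` the term `b * d k` cancels. What remains are terms `d s b *
d (k - s)` with `s ≥ 1`, of lower order by induction. -/
theorem IsHigherDerivation.hasOrderLE {d : ℕ → Module.End K B} (hd : IsHigherDerivation d)
    (k : ℕ) : HasOrderLE K B k (d k) := by
  induction k using Nat.strong_induction_on with
  | _ k ih =>
    cases k with
    | zero => exact ⟨1, by rw [hd.zero, map_one]⟩
    | succ k =>
      intro b
      rw [hd.mul_lmul, Finset.Nat.antidiagonal_succ, Finset.sum_cons, hd.zero,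
        Module.End.one_apply, sub_add_cancel_left]
      refine HasOrderLE.neg (HasOrderLE.sum _ fun q hq => ?_)
      obtain ⟨q', hq', rfl⟩ := Finset.mem_map.1 hq
      have h2 : q'.2 ≤ k := by
        have := Finset.HasAntidiagonal.mem_antidiagonal.1 hq'
        omega
      exact ((ih q'.2 (by omega)).mono h2).lmul_mul _

theorem IsIterative.first_pow {d : ℕ → Module.End K B} (hd : IsIterative d) (t : ℕ) :
    d 1 ^ t = t.factorial • d t := by
  induction t with
  | zero => simp [hd.zero]
  | succ t ih =>
    rw [pow_succ', ih, mul_smul_comm, hd.iterate, smul_smul, add_comm 1 t, Nat.choose_one_right,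
      Nat.factorial_succ, mul_comm]

end HigherDerivation

/-! ### Operators are determined by their values at monomials -/

section Coordinates

variable {K B N : Type*} [CommRing K] [CommRing B] [Algebra K B]

/-- If derivations of `B` are determined by their values at the `x ν`, then a differential
operator commuting with all `x ν` is the multiplication by an element. -/
theorem HasOrderLE.eq_lmul_of_commute {x : N → B}
    (hx : ∀ D : Derivation K B B, (∀ ν, D (x ν) = 0) → D = 0) {k : ℕ} {u : Module.End K B}
    (hu : HasOrderLE K B k u) (hc : ∀ ν, Commute (Algebra.lmul K B (x ν)) u) :
    HasOrderLE K B 0 u := by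
  induction k generalizing u with
  | zero => exact hu
  | succ k ih =>
    have h1 : ∀ b, HasOrderLE K B 0 (Algebra.lmul K B b * u - u * Algebra.lmul K B b) := by
      intro b
      refine ih (hu b) fun ν => ?_
      have hb : Commute (Algebra.lmul K B (x ν)) (Algebra.lmul K B b) := by
        rw [Commute, SemiconjBy, ← map_mul, ← map_mul, mul_comm]
      exact (hb.mul_right (hc ν)).sub_right ((hc ν).mul_right hb)
    -- A multiplication operator is multiplication by its value at `1`; here it is the commutator of
    -- `b` and `u`.
    have h2 : ∀ b y, b * u y - u (b * y) = (b * u 1 - u b) * y := by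
      intro b y
      obtain ⟨c, hcb⟩ := h1 b
      have h3 := LinearMap.congr_fun hcb y
      have h4 := LinearMap.congr_fun hcb 1
      simp only [LinearMap.sub_apply, Module.End.mul_apply, lmul_eq_mul, mul_one] at h3 h4
      rw [h3, h4]
    let D : Derivation K B B := Derivation.mk'
      (LinearMap.mulRight K (u 1) - u) (by
        intro a b
        have h3 := h2 a b
        simp only [LinearMap.sub_apply, LinearMap.mulRight_apply, smul_eq_mul]
        linear_combination h3)
    have hD : D = 0 := hx D fun ν => by
      have h3 := LinearMap.congr_fun (hc ν).eq 1
      simp only [Module.End.mul_apply, lmul_eq_mul, mul_one] at h3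
      simp [D, h3]
    refine ⟨u 1, LinearMap.ext fun b => ?_⟩
    have h3 : D b = 0 := by rw [hD]; rfl
    have h4 : b * u 1 - u b = 0 := h3
    rw [lmul_eq_mul]
    linear_combination -h4

section

variable [DecidableEq N]

/-- `d` is a higher derivation with `x ν ↦ x ν + t` and `x μ ↦ x μ` for `μ ≠ ν`. -/
structure IsPartial (x : N → B) (ν : N) (d : ℕ → Module.End K B) : Prop
    extends IsHigherDerivation d where
  first : ∀ μ, d 1 (x μ) = if ν = μ then 1 else 0
  higher : ∀ μ k, 2 ≤ k → d k (x μ) = 0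

theorem IsPartial.series_coord {x : N → B} {ν : N} {d : ℕ → Module.End K B}
    (hd : IsPartial x ν d) (μ : N) :
    hd.series (x μ) = C (x μ) + if ν = μ then X else 0 := by
  ext k
  rw [IsHigherDerivation.coeff_series]
  match k with
  | 0 => simp [hd.zero, apply_ite]
  | 1 =>
    rw [hd.first, map_add, coeff_C, if_neg one_ne_zero, zero_add]
    split_ifs <;> simp
  | k + 2 =>
    rw [hd.higher _ _ (by omega), map_add, coeff_C, if_neg (by omega), zero_add]
    split_ifs <;> simp [coeff_X]

end

variable [Fintype N]

/-- The monomial `x ^ β`. -/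
def monom (x : N → B) (β : N → ℕ) : B := ∏ ν, x ν ^ β ν

theorem monom_zero (x : N → B) : monom x 0 = 1 := by simp [monom]

variable [DecidableEq N]

/-- The series of `x ν ^ β ν` is `(x ν + t) ^ β ν`, and the other factors are sent to constant
series. -/
theorem IsPartial.apply_monom {x : N → B} {ν : N} {d : ℕ → Module.End K B}
    (hd : IsPartial x ν d) (k : ℕ) (β : N → ℕ) :
    d k (monom x β) =
      (β ν).choose k • monom x (Function.update β ν (β ν - k)) := by
  have h1 : ∀ γ : N → ℕ, monom x γ = x ν ^ γ ν * ∏ μ ∈ Finset.univ.erase ν, x μ ^ γ μ := fun γ =>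
    (Finset.mul_prod_erase _ _ (Finset.mem_univ ν)).symm
  have h2 : hd.series (∏ μ ∈ Finset.univ.erase ν, x μ ^ β μ) =
      C (∏ μ ∈ Finset.univ.erase ν, x μ ^ β μ) := by
    rw [map_prod, map_prod]
    refine Finset.prod_congr rfl fun μ hμ => ?_
    rw [map_pow, map_pow, hd.series_coord, if_neg (Finset.ne_of_mem_erase hμ).symm, add_zero]
  have h3 : hd.series (x ν ^ β ν) = ((Polynomial.X + Polynomial.C (x ν)) ^ β ν : Polynomial B) := by
    rw [map_pow, hd.series_coord, if_pos rfl]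
    simp [add_comm]
  rw [← hd.coeff_series, h1, map_mul, h2, h3, coeff_mul_C, Polynomial.coeff_coe,
    Polynomial.coeff_X_add_C_pow, h1 (Function.update _ _ _), Function.update_self,
    nsmul_eq_mul]
  have h4 : ∏ μ ∈ Finset.univ.erase ν, x μ ^ (Function.update β ν (β ν - k) μ) =
      ∏ μ ∈ Finset.univ.erase ν, x μ ^ β μ :=
    Finset.prod_congr rfl fun μ hμ => by rw [Function.update_of_ne (Finset.ne_of_mem_erase hμ)]
  rw [h4]
  ring

theorem monom_add_single (x : N → B) (β : N → ℕ) (ν : N) :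
    monom x (β + Pi.single ν 1) = x ν * monom x β := by
  have : ∏ μ, x μ ^ (Pi.single ν 1 : N → ℕ) μ = x ν := by
    rw [Finset.prod_eq_single ν (fun μ _ h => by simp [Pi.single_eq_of_ne h]) (by simp)]
    simp
  simp only [monom, Pi.add_apply, pow_add, Finset.prod_mul_distrib, this]
  rw [mul_comm]

/-- A differential operator of order at most `k` that kills all monomials of degree at most `k`
vanishes. -/
theorem HasOrderLE.eq_zero {x : N → B}
    (hx : ∀ D : Derivation K B B, (∀ ν, D (x ν) = 0) → D = 0) {k : ℕ} {u : Module.End K B}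
    (hu : HasOrderLE K B k u) (h0 : ∀ β : N → ℕ, ∑ ν, β ν ≤ k → u (monom x β) = 0) : u = 0 := by
  have h1 : ∀ v : Module.End K B, HasOrderLE K B 0 v → v 1 = 0 → v = 0 := by
    rintro _ ⟨c, rfl⟩ hv
    rw [lmul_eq_mul, mul_one] at hv
    rw [hv, map_zero]
  have hu1 : u 1 = 0 := by
    rw [← monom_zero x]
    exact h0 0 (by simp)
  induction k generalizing u with
  | zero => exact h1 u hu hu1
  | succ k ih =>
    refine h1 u (hu.eq_lmul_of_commute hx fun ν => ?_) hu1
    have h2 : ∀ β : N → ℕ, ∑ ν, β ν ≤ k →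
        (Algebra.lmul K B (x ν) * u - u * Algebra.lmul K B (x ν)) (monom x β) = 0 := by
      intro β hβ
      rw [LinearMap.sub_apply, Module.End.mul_apply, Module.End.mul_apply, lmul_eq_mul,
        lmul_eq_mul, ← monom_add_single, h0 β (by omega), h0, mul_zero, sub_zero]
      simp only [Pi.add_apply, Finset.sum_add_distrib, Finset.sum_pi_single', Finset.mem_univ,
        if_true]
      omega
    refine sub_eq_zero.1 (ih (hu (x ν)) h2 ?_)
    rw [← monom_zero x]
    exact h2 0 (by simp)

theorem eq_of_mem_diffOps {x : N → B}
    (hx : ∀ D : Derivation K B B, (∀ ν, D (x ν) = 0) → D = 0) {u v : Module.End K B}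
    (hu : u ∈ diffOps K B) (hv : v ∈ diffOps K B)
    (h : ∀ β : N → ℕ, u (monom x β) = v (monom x β)) : u = v := by
  obtain ⟨k, hk⟩ := (diffOps K B).sub_mem hu hv
  exact sub_eq_zero.1 (hk.eq_zero hx fun β _ => by rw [LinearMap.sub_apply, h, sub_self])

theorem IsHigherDerivation.mem_diffOps {d : ℕ → Module.End K B} (hd : IsHigherDerivation d)
    (k : ℕ) : d k ∈ diffOps K B := ⟨k, hd.hasOrderLE k⟩

theorem IsPartial.unique {x : N → B}
    (hx : ∀ D : Derivation K B B, (∀ ν, D (x ν) = 0) → D = 0) {ν : N}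
    {d d' : ℕ → Module.End K B} (hd : IsPartial x ν d) (hd' : IsPartial x ν d') : d = d' := by
  ext1 k
  refine eq_of_mem_diffOps hx (hd.mem_diffOps k) (hd'.mem_diffOps k) fun β => ?_
  rw [hd.apply_monom, hd'.apply_monom]

/-- On monomials the claim is the identity `C(b, l) C(b - l, k) = C(k + l, k) C(b, k + l)`. -/
theorem IsPartial.isIterative {x : N → B}
    (hx : ∀ D : Derivation K B B, (∀ ν, D (x ν) = 0) → D = 0) {ν : N}
    {d : ℕ → Module.End K B} (hd : IsPartial x ν d) : IsIterative d where
  toIsHigherDerivation := hd.toIsHigherDerivation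
  iterate k l := by
    refine eq_of_mem_diffOps hx ((diffOps K B).mul_mem (hd.mem_diffOps k) (hd.mem_diffOps l))
      ((diffOps K B).nsmul_mem (hd.mem_diffOps _) _) fun β => ?_
    rw [Module.End.mul_apply, LinearMap.smul_apply, hd.apply_monom, hd.apply_monom, map_nsmul,
      hd.apply_monom, Function.update_self, Function.update_idem, smul_smul, smul_smul,
      Nat.sub_sub, add_comm l k]
    congr 1
    rw [mul_comm ((k + l).choose k)]
    have h := Nat.choose_mul (n := β ν) (Nat.le_add_left l k)
    rw [Nat.add_sub_cancel, ← Nat.choose_symm_add] at h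
    exact h.symm

/-- For `ν ≠ μ` the two operators change different exponents. For `ν = μ` uniqueness identifies the
two families, and iterativity is symmetric in `k` and `l`. -/
theorem IsPartial.commute {x : N → B}
    (hx : ∀ D : Derivation K B B, (∀ ν, D (x ν) = 0) → D = 0) {ν μ : N}
    {d d' : ℕ → Module.End K B} (hd : IsPartial x ν d) (hd' : IsPartial x μ d') (k l : ℕ) :
    Commute (d k) (d' l) := by
  by_cases h : ν = μ
  · subst h
    obtain rfl := hd.unique hx hd'
    have hi := hd.isIterative hx
    rw [Commute, SemiconjBy, hi.iterate, hi.iterate, add_comm l k, Nat.choose_symm_add]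
  · refine eq_of_mem_diffOps hx ((diffOps K B).mul_mem (hd.mem_diffOps k) (hd'.mem_diffOps l))
      ((diffOps K B).mul_mem (hd'.mem_diffOps l) (hd.mem_diffOps k)) fun β => ?_
    rw [Module.End.mul_apply, Module.End.mul_apply, hd.apply_monom, hd'.apply_monom, map_nsmul,
      map_nsmul, hd.apply_monom, hd'.apply_monom, Function.update_of_ne h,
      Function.update_of_ne (Ne.symm h), Function.update_comm h, smul_smul, smul_smul, mul_comm]

end Coordinates

/-! ### The products of divided powers as a basis of the differential operators -/

section NormalForm

variable {K B N T : Type*} [CommRing K] [CommRing B] [Algebra K B] [Ring T] [Algebra K T]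
  [Fintype N]

theorem pairwise_commute {N : Type*} {g : N → ℕ → T}
    (hg : ∀ ν μ k l, Commute (g ν k) (g μ l)) (α : N → ℕ) (s : Finset N) :
    (s : Set N).Pairwise (Function.onFun Commute fun ν => g ν (α ν)) :=
  fun _ _ _ _ _ => hg _ _ _ _

/-- The product `∏ g ν (α ν)` for a family of commuting elements. -/
def multi (g : N → ℕ → T) (hg : ∀ ν μ k l, Commute (g ν k) (g μ l)) (α : N → ℕ) : T :=
  Finset.univ.noncommProd (fun ν => g ν (α ν)) (pairwise_commute hg α _)

/-- The map `(b α) ↦ ∑ b α * ∏ g ν (α ν)`. -/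
noncomputable def normalForm (ι : B →ₐ[K] T) (g : N → ℕ → T)
    (hg : ∀ ν μ k l, Commute (g ν k) (g μ l)) : ((N → ℕ) →₀ B) →ₗ[K] T :=
  Finsupp.lsum K fun α => LinearMap.mulRight K (multi g hg α) ∘ₗ ι.toLinearMap

theorem normalForm_single (ι : B →ₐ[K] T) (g : N → ℕ → T)
    (hg : ∀ ν μ k l, Commute (g ν k) (g μ l)) (α : N → ℕ) (b : B) :
    normalForm ι g hg (Finsupp.single α b) = ι b * multi g hg α := by
  simp [normalForm]

theorem normalForm_apply (ι : B →ₐ[K] T) (g : N → ℕ → T)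
    (hg : ∀ ν μ k l, Commute (g ν k) (g μ l)) (c : (N → ℕ) →₀ B) :
    normalForm ι g hg c = ∑ α ∈ c.support, ι (c α) * multi g hg α := by
  simp [normalForm, Finsupp.sum]

theorem map_normalForm {T' : Type*} [Ring T'] [Algebra K T'] (Φ : T →ₐ[K] T') (ι : B →ₐ[K] T)
    (g : N → ℕ → T) (hg : ∀ ν μ k l, Commute (g ν k) (g μ l)) (c : (N → ℕ) →₀ B) :
    Φ (normalForm ι g hg c) = normalForm (Φ.comp ι) (fun ν k => Φ (g ν k))
      (fun ν μ k l => (hg ν μ k l).map Φ) c := by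
  rw [normalForm_apply, normalForm_apply, map_sum]
  refine Finset.sum_congr rfl fun α _ => ?_
  rw [map_mul, multi, Finset.map_noncommProd]
  rfl

variable [DecidableEq N]

theorem mul_multi {g : N → ℕ → T} (hg : ∀ ν μ k l, Commute (g ν k) (g μ l))
    (hi : ∀ ν k l, g ν k * g ν l = (k + l).choose k • g ν (k + l)) (ν : N) (k : ℕ) (α : N → ℕ) :
    g ν k * multi g hg α =
      (k + α ν).choose k • multi g hg (Function.update α ν (k + α ν)) := by
  have h1 : ∀ γ : N → ℕ, multi g hg γ = g ν (γ ν) *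
      (Finset.univ.erase ν).noncommProd (fun μ => g μ (γ μ)) (pairwise_commute hg γ _) :=
    fun γ => (Finset.mul_noncommProd_erase _ (Finset.mem_univ ν) (fun μ => g μ (γ μ)) _).symm
  rw [h1, h1, ← mul_assoc, hi, Function.update_self, smul_mul_assoc]
  congr 2
  exact Finset.noncommProd_congr rfl (fun μ hμ => by
    rw [Function.update_of_ne (Finset.ne_of_mem_erase hμ)]) _

variable {x : N → B} {δ : N → ℕ → Module.End K B}

theorem multi_apply_monom (hδ : ∀ ν, IsPartial x ν (δ ν))
    (hc : ∀ ν μ k l, Commute (δ ν k) (δ μ l)) (α β : N → ℕ) :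
    multi δ hc α (monom x β) = (∏ ν, (β ν).choose (α ν)) • monom x (β - α) := by
  have key : ∀ s : Finset N, (s.noncommProd (fun ν => δ ν (α ν)) (pairwise_commute hc α _))
      (monom x β) = (∏ ν ∈ s, (β ν).choose (α ν)) •
        monom x (fun μ => if μ ∈ s then β μ - α μ else β μ) := by
    intro s
    induction s using Finset.induction_on with
    | empty => simp
    | insert a s ha ih =>
      rw [Finset.noncommProd_insert_of_notMem _ _ _ _ ha, Module.End.mul_apply, ih, map_nsmul,
        (hδ a).apply_monom, if_neg ha, Finset.prod_insert ha, smul_smul, mul_comm]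
      congr 2
      ext μ
      by_cases hμ : μ = a
      · subst hμ
        simp
      · simp [Finset.mem_insert, hμ]
  rw [multi, key]
  congr 2
  ext μ
  simp

theorem multi_apply_monom_self (hδ : ∀ ν, IsPartial x ν (δ ν))
    (hc : ∀ ν μ k l, Commute (δ ν k) (δ μ l)) (α : N → ℕ) :
    multi δ hc α (monom x α) = 1 := by
  simp [multi_apply_monom hδ, monom_zero]

/-- Some exponent of `α` exceeds that of `β`, so one binomial factor vanishes. Together with
`multi_apply_monom_self` this is the triangularity used for spanning and for independence. -/
theorem multi_apply_monom_of_ne (hδ : ∀ ν, IsPartial x ν (δ ν))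
    (hc : ∀ ν μ k l, Commute (δ ν k) (δ μ l)) {α β : N → ℕ} (hne : α ≠ β)
    (hle : ∑ ν, β ν ≤ ∑ ν, α ν) : multi δ hc α (monom x β) = 0 := by
  obtain ⟨ν, hν⟩ : ∃ ν, β ν < α ν := by
    by_contra! h
    exact hne (funext fun ν =>
      ((Finset.sum_eq_sum_iff_of_le fun ν _ => h ν).1
        (le_antisymm (Finset.sum_le_sum fun ν _ => h ν) hle) ν (Finset.mem_univ ν)))
  rw [multi_apply_monom hδ, Finset.prod_eq_zero (Finset.mem_univ ν) (Nat.choose_eq_zero_of_lt hν),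
    zero_smul]

theorem hasOrderLE_multi (hδ : ∀ ν, IsPartial x ν (δ ν))
    (hc : ∀ ν μ k l, Commute (δ ν k) (δ μ l)) (α : N → ℕ) :
    HasOrderLE K B (∑ ν, α ν) (multi δ hc α) := by
  have key : ∀ s : Finset N, HasOrderLE K B (∑ ν ∈ s, α ν)
      (s.noncommProd (fun ν => δ ν (α ν)) (pairwise_commute hc α _)) := by
    intro s
    induction s using Finset.induction_on with
    | empty =>
      rw [Finset.noncommProd_empty]
      exact ⟨1, (map_one _).symm⟩
    | insert a s ha ih =>
      rw [Finset.noncommProd_insert_of_notMem _ _ _ _ ha, Finset.sum_insert ha]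
      exact HasOrderLE.mul_aux _ _ _ rfl ((hδ a).hasOrderLE _) ih
  exact key _

/-- Every differential operator lies in each algebra that contains `B` and the `δ ν k`. -/
theorem diffOps_le (hx : ∀ D : Derivation K B B, (∀ ν, D (x ν) = 0) → D = 0)
    (hδ : ∀ ν, IsPartial x ν (δ ν)) {W : Subalgebra K (Module.End K B)}
    (hB : ∀ b, Algebra.lmul K B b ∈ W) (hW : ∀ ν k, δ ν k ∈ W) : diffOps K B ≤ W := by
  have hc : ∀ ν μ k l, Commute (δ ν k) (δ μ l) := fun ν μ => (hδ ν).commute hx (hδ μ)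
  have hmulti : ∀ α, multi δ hc α ∈ W := fun α =>
    Finset.noncommProd_induction _ _ _ (· ∈ W) (fun _ _ => W.mul_mem) W.one_mem fun ν _ => hW ν _
  rintro u ⟨k, hu⟩
  -- The operator `u` is approximated degree by degree. The bound on the order of `w` is carried
  -- along so that agreement up to degree `k` forces `u = w`.
  have key : ∀ d ≤ k + 1, ∃ w ∈ W, HasOrderLE K B k w ∧
      ∀ β : N → ℕ, ∑ ν, β ν < d → w (monom x β) = u (monom x β) := by
    intro d
    induction d with
    | zero => exact fun _ => ⟨0, W.zero_mem, HasOrderLE.zero_mem k, by simp⟩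
    | succ d ih =>
      intro hd
      obtain ⟨w, hwW, hwk, hw⟩ := ih (by omega)
      have hdeg : ∀ α ∈ Finset.univ.piAntidiag d, ∑ ν : N, α ν = d := fun α hα =>
        (Finset.mem_piAntidiag.1 hα).1
      -- The correction at `α` has the error at `x^α` as coefficient. It vanishes at monomials of
      -- smaller degree and at the other monomials of degree `d`.
      refine ⟨w + ∑ α ∈ Finset.univ.piAntidiag d,
        Algebra.lmul K B ((u - w) (monom x α)) * multi δ hc α,
        W.add_mem hwW (W.sum_mem fun α _ => W.mul_mem (hB _) (hmulti α)),
        hwk.add (HasOrderLE.sum _ fun α hα => ?_), fun β hβ => ?_⟩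
      · refine ((hasOrderLE_multi hδ hc α).mono ?_).lmul_mul _
        rw [hdeg α hα]
        omega
      · rw [LinearMap.add_apply, LinearMap.sum_apply]
        rcases Nat.lt_succ_iff_lt_or_eq.1 hβ with h | h
        · rw [hw β h, Finset.sum_eq_zero, add_zero]
          intro α hα
          have hα' := hdeg α hα
          rw [Module.End.mul_apply, multi_apply_monom_of_ne hδ hc (by rintro rfl; omega) (by omega),
            map_zero]
        · rw [Finset.sum_eq_single β]
          · rw [Module.End.mul_apply, multi_apply_monom_self hδ, lmul_eq_mul, mul_one,
              LinearMap.sub_apply, add_sub_cancel]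
          · intro α hα hne
            have hα' := hdeg α hα
            rw [Module.End.mul_apply, multi_apply_monom_of_ne hδ hc hne (by omega), map_zero]
          · intro h'
            exact (h' (Finset.mem_piAntidiag.2 ⟨h, fun ν _ => Finset.mem_univ ν⟩)).elim
  obtain ⟨w, hwW, hwk, hw⟩ := key (k + 1) le_rfl
  have h0 : u - w = 0 := (hu.sub hwk).eq_zero hx fun β hβ => by
    rw [LinearMap.sub_apply, hw β (by omega), sub_self]
  rwa [sub_eq_zero.1 h0]

/-- Evaluation at `x^α`, with `α` of least degree in the support, isolates the coefficient at `α`.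
-/
theorem normalForm_injective (hδ : ∀ ν, IsPartial x ν (δ ν))
    (hc : ∀ ν μ k l, Commute (δ ν k) (δ μ l)) :
    Function.Injective (normalForm (Algebra.lmul K B) δ hc) := by
  rw [injective_iff_map_eq_zero]
  intro c h0
  by_contra hne
  obtain ⟨α, hα, hmin⟩ := c.support.exists_min_image (fun α => ∑ ν, α ν)
    (Finsupp.support_nonempty_iff.2 hne)
  have h1 := LinearMap.congr_fun h0 (monom x α)
  rw [normalForm_apply, LinearMap.sum_apply, Finset.sum_eq_single α] at h1
  · rw [Module.End.mul_apply, multi_apply_monom_self hδ, lmul_eq_mul, mul_one] at h1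
    exact Finsupp.mem_support_iff.1 hα h1
  · intro β hβ hβα
    rw [Module.End.mul_apply, multi_apply_monom_of_ne hδ hc hβα (hmin β hβ), map_zero]
  · exact fun h => (h hα).elim

end NormalForm

/-! ### The presented algebra and its normal forms -/

section Presentation

variable {K B N M : Type*} [CommRing K] [CommRing B] [Algebra K B] [DecidableEq N]
  (x : N → B) (y : M → B) (δ : N → ℕ → Module.End K B)

/-- The image of `δ_ν^{[k]}` in the presented algebra. -/
noncomputable def presentedDelta (ν : N) (k : ℕ) : Presented x y δ :=
  RingQuot.mkAlgHom K (Rel x y δ) (deltaGen K B ν k)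

/-- The copy of the coefficient algebra in the presented algebra. -/
noncomputable def presentedCoeff : B →ₐ[K] Presented x y δ :=
  AlgHom.ofLinearMap
    { toFun := fun b => RingQuot.mkAlgHom K (Rel x y δ) (coeffGen K N b)
      map_add' := fun a b => by
        rw [RingQuot.mkAlgHom_rel K (Rel.coeff_add a b), map_add]
      map_smul' := fun c b => by
        rw [Algebra.smul_def, RingQuot.mkAlgHom_rel K (Rel.coeff_mul _ b), map_mul,
          RingQuot.mkAlgHom_rel K (Rel.coeff_scalar c), AlgHom.commutes, Algebra.smul_def,
          RingHom.id_apply] }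
    (by
      change RingQuot.mkAlgHom K (Rel x y δ) (coeffGen K N 1) = 1
      rw [← (algebraMap K B).map_one, RingQuot.mkAlgHom_rel K (Rel.coeff_scalar 1), map_one,
        map_one])
    (fun a b => by
      change RingQuot.mkAlgHom K (Rel x y δ) (coeffGen K N (a * b)) = _
      rw [RingQuot.mkAlgHom_rel K (Rel.coeff_mul a b), map_mul]
      rfl)

theorem presentedDelta_zero (ν : N) : presentedDelta x y δ ν 0 = 1 := by
  rw [presentedDelta, RingQuot.mkAlgHom_rel K (Rel.delta_zero ν), map_one]

theorem presentedDelta_commute (ν μ : N) (k l : ℕ) :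
    Commute (presentedDelta x y δ ν k) (presentedDelta x y δ μ l) := by
  rcases Nat.eq_zero_or_pos k with rfl | hk
  · rw [presentedDelta_zero]
    exact Commute.one_left _
  rcases Nat.eq_zero_or_pos l with rfl | hl
  · rw [presentedDelta_zero]
    exact Commute.one_right _
  have h := RingQuot.mkAlgHom_rel K (Rel.delta_comm (x := x) (y := y) (δ := δ) ν μ k l hk hl)
  rw [map_sub, map_mul, map_mul, map_zero] at h
  exact sub_eq_zero.1 h

theorem presentedDelta_iterate (ν : N) (k l : ℕ) :
    presentedDelta x y δ ν k * presentedDelta x y δ ν l =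
      (k + l).choose k • presentedDelta x y δ ν (k + l) := by
  rcases Nat.eq_zero_or_pos k with rfl | hk
  · simp [presentedDelta_zero]
  rcases Nat.eq_zero_or_pos l with rfl | hl
  · simp [presentedDelta_zero]
  have h := RingQuot.mkAlgHom_rel K (Rel.delta_iterate (x := x) (y := y) (δ := δ) ν k l hk hl)
  rwa [map_mul, map_nsmul] at h

variable {x y δ}

/-- The elements `b` with `δ_ν^{[k]} b = ∑ δ_ν^{[s]}(b) δ_ν^{[k-s]}` for all `k`. -/
noncomputable def leibnizSubalgebra {ν : N} (hν : IsHigherDerivation (δ ν)) : Subalgebra K B where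
  carrier := {b | PowerSeries.mk (presentedDelta x y δ ν) * C (presentedCoeff x y δ b) =
    PowerSeries.map (presentedCoeff x y δ : B →+* Presented x y δ) (hν.series b) *
      PowerSeries.mk (presentedDelta x y δ ν)}
  mul_mem' := by
    intro a b ha hb
    simp only [Set.mem_ofPred_eq] at ha hb ⊢
    rw [map_mul, map_mul, map_mul, map_mul, ← mul_assoc, ha, mul_assoc, hb, mul_assoc]
  add_mem' := by
    intro a b ha hb
    simp only [Set.mem_ofPred_eq] at ha hb ⊢
    rw [map_add, map_add, map_add, map_add, mul_add, add_mul, ha, hb]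
  algebraMap_mem' := by
    intro c
    have h : hν.series (algebraMap K B c) = C (algebraMap K B c) := by
      ext k
      have h1 : δ ν k (algebraMap K B c) = c • coeff k (hν.series 1) := by
        rw [hν.coeff_series, Algebra.algebraMap_eq_smul_one, map_smul]
      rw [hν.coeff_series, h1, map_one, coeff_one, coeff_C]
      split_ifs <;> simp [Algebra.algebraMap_eq_smul_one]
    simp only [Set.mem_ofPred_eq]
    rw [h, PowerSeries.map_C]
    ext k
    simp only [coeff_mul_C, coeff_C_mul, RingHom.coe_coe, AlgHom.commutes]
    exact (Algebra.commutes _ _).symm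

theorem mem_leibnizSubalgebra {ν : N} (hν : IsHigherDerivation (δ ν)) {b : B} :
    b ∈ leibnizSubalgebra (x := x) (y := y) hν ↔
      ∀ k, presentedDelta x y δ ν k * presentedCoeff x y δ b =
        ∑ q ∈ Finset.HasAntidiagonal.antidiagonal k,
          presentedCoeff x y δ (δ ν q.1 b) * presentedDelta x y δ ν q.2 := by
  change _ = _ ↔ _
  rw [PowerSeries.ext_iff]
  refine forall_congr' fun k => ?_
  rw [coeff_mul_C, coeff_mul]
  simp

/-- The relation for `a` says `θ a = E(a) θ`, with `E` the generating series. Multiplying by `E(b)`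
on the left and by `b` on the right gives the relation for `b`. No relations for denominators are
therefore needed. -/
theorem mem_leibnizSubalgebra_of_mul_eq_one {ν : N} (hν : IsHigherDerivation (δ ν)) {a b : B}
    (hab : a * b = 1) (ha : a ∈ leibnizSubalgebra (x := x) (y := y) hν) :
    b ∈ leibnizSubalgebra (x := x) (y := y) hν := by
  change _ = _ at ha
  change _ = _
  set ι := (presentedCoeff x y δ : B →+* Presented x y δ)
  set θ := PowerSeries.mk (presentedDelta x y δ ν)
  have hba : PowerSeries.map ι (hν.series b) * PowerSeries.map ι (hν.series a) = 1 := by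
    rw [← map_mul, ← map_mul, mul_comm, hab, map_one, map_one]
  have hab' : (C (presentedCoeff x y δ a) : PowerSeries (Presented x y δ)) *
      C (presentedCoeff x y δ b) = 1 := by
    rw [← map_mul, ← map_mul, hab, map_one, map_one]
  calc θ * C (presentedCoeff x y δ b)
      = PowerSeries.map ι (hν.series b) * (PowerSeries.map ι (hν.series a) * θ) *
          C (presentedCoeff x y δ b) := by rw [← mul_assoc, hba, one_mul]
    _ = PowerSeries.map ι (hν.series b) * θ := by
          rw [← ha, mul_assoc, mul_assoc, hab', mul_one]

theorem coord_mem_leibnizSubalgebra {ν : N} (hν : IsPartial x ν (δ ν)) (μ : N) :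
    x μ ∈ leibnizSubalgebra (x := x) (y := y) hν.toIsHigherDerivation := by
  rw [mem_leibnizSubalgebra]
  intro k
  cases k with
  | zero => simp [presentedDelta_zero, hν.zero]
  | succ k =>
    have h := RingQuot.mkAlgHom_rel K
      (Rel.delta_x (x := x) (y := y) (δ := δ) ν μ (k + 1) (by omega))
    rw [map_sub, map_mul, map_mul, Nat.add_sub_cancel, apply_ite (RingQuot.mkAlgHom K (Rel x y δ)),
      map_zero, sub_eq_iff_eq_add] at h
    change presentedDelta x y δ ν (k + 1) * presentedCoeff x y δ (x μ) =
      (if ν = μ then presentedDelta x y δ ν k else 0) +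
        presentedCoeff x y δ (x μ) * presentedDelta x y δ ν (k + 1) at h
    rw [h, Finset.Nat.antidiagonal_succ, Finset.sum_cons, hν.zero, Module.End.one_apply, add_comm]
    congr 1
    -- First indices are shifted by one: `(0, k)` stands for the term with `δ ν 1 (x μ)`, and the
    -- others vanish by `higher`.
    rw [Finset.sum_map, Finset.sum_eq_single (0, k)]
    · change _ = presentedCoeff x y δ (δ ν 1 (x μ)) * _
      rw [hν.first]
      split_ifs <;> simp
    · rintro ⟨a, b⟩ hq hne
      have hq' := Finset.HasAntidiagonal.mem_antidiagonal.1 hq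
      simp only at hq'
      have ha : a ≠ 0 := by
        rintro rfl
        exact hne (by rw [← hq', zero_add])
      change presentedCoeff x y δ (δ ν (a + 1) (x μ)) * _ = 0
      rw [hν.higher _ _ (by omega), map_zero, zero_mul]
    · intro h'
      exact (h' (Finset.HasAntidiagonal.mem_antidiagonal.2 (zero_add k))).elim

theorem sum_antidiagonal_eq_add_sum_Icc {T : Type*} [AddCommMonoid T] (F : ℕ → ℕ → T) (k : ℕ) :
    ∑ q ∈ Finset.HasAntidiagonal.antidiagonal k, F q.1 q.2 =
      F 0 k + ∑ t ∈ Finset.Icc 1 k, F t (k - t) := by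
  rw [Finset.Nat.sum_antidiagonal_eq_sum_range_succ F, Finset.sum_range_succ', add_comm,
    Nat.sub_zero, ← Finset.Ico_add_one_right_eq_Icc, Finset.sum_Ico_eq_sum_range]
  simp [add_comm]

theorem dependent_mem_leibnizSubalgebra {ν : N} (hν : IsHigherDerivation (δ ν)) (s : M) :
    y s ∈ leibnizSubalgebra (x := x) (y := y) hν := by
  rw [mem_leibnizSubalgebra]
  intro k
  rw [sum_antidiagonal_eq_add_sum_Icc (fun a b => presentedCoeff x y δ (δ ν a (y s)) *
    presentedDelta x y δ ν b), hν.zero, Module.End.one_apply]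
  rcases Nat.eq_zero_or_pos k with rfl | hk
  · simp [presentedDelta_zero]
  have h := RingQuot.mkAlgHom_rel K (Rel.delta_y (x := x) (y := y) (δ := δ) ν s k hk)
  rw [map_sub, map_mul, map_mul, map_sum, sub_eq_iff_eq_add'] at h
  simp only [map_mul] at h
  exact h

variable [Fintype N]

/-- The span of the normal forms contains `1` and is stable under left multiplication by the
generators: a `δ` is moved past the coefficient and merged into the product by the divided power
rule. The hypothesis `hgen` says that coordinates and inverses generate `B`, and extends the
commutation rule from coordinates to `B`. -/
theorem normalForm_presented_surjective (hδ : ∀ ν, IsPartial x ν (δ ν))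
    (hgen : ∀ W : Subalgebra K B, (∀ ν, x ν ∈ W) → (∀ s, y s ∈ W) →
      (∀ a b, a * b = 1 → a ∈ W → b ∈ W) → W = ⊤) :
    Function.Surjective (normalForm (presentedCoeff x y δ) (presentedDelta x y δ)
      (presentedDelta_commute x y δ)) := by
  set Ψ := normalForm (presentedCoeff x y δ) (presentedDelta x y δ)
      (presentedDelta_commute x y δ) with hΨ
  have hleib : ∀ ν b k, presentedDelta x y δ ν k * presentedCoeff x y δ b =
      ∑ q ∈ Finset.HasAntidiagonal.antidiagonal k,
        presentedCoeff x y δ (δ ν q.1 b) * presentedDelta x y δ ν q.2 := by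
    intro ν b
    rw [← mem_leibnizSubalgebra (hδ ν).toIsHigherDerivation,
      hgen (leibnizSubalgebra (x := x) (y := y) (hδ ν).toIsHigherDerivation)
        (coord_mem_leibnizSubalgebra (hδ ν))
        (dependent_mem_leibnizSubalgebra (hδ ν).toIsHigherDerivation)
        (fun _ _ => mem_leibnizSubalgebra_of_mul_eq_one (hδ ν).toIsHigherDerivation)]
    trivial
  have hmem : ∀ b α, presentedCoeff x y δ b * multi (presentedDelta x y δ)
      (presentedDelta_commute x y δ) α ∈ LinearMap.range Ψ := fun b α =>
    ⟨Finsupp.single α b, normalForm_single _ _ _ _ _⟩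
  have hone : (1 : Presented x y δ) ∈ LinearMap.range Ψ := by
    have h := hmem 1 0
    have h1 : multi (presentedDelta x y δ) (presentedDelta_commute x y δ) 0 = 1 :=
      (Finset.noncommProd_eq_pow_card _ _ _ 1
        (fun ν _ => presentedDelta_zero x y δ ν)).trans (one_pow _)
    rwa [map_one, one_mul, h1] at h
  have hleft : ∀ w : Presented x y δ, (∀ b α, w * (presentedCoeff x y δ b *
      multi (presentedDelta x y δ) (presentedDelta_commute x y δ) α) ∈ LinearMap.range Ψ) →
      ∀ v ∈ LinearMap.range Ψ, w * v ∈ LinearMap.range Ψ := by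
    rintro w hw _ ⟨c, rfl⟩
    rw [hΨ, normalForm_apply, Finset.mul_sum]
    exact Submodule.sum_mem _ fun α _ => hw _ _
  have key : ∀ a : FreeAlgebra K (B ⊕ N × ℕ), ∀ v ∈ LinearMap.range Ψ,
      RingQuot.mkAlgHom K (Rel x y δ) a * v ∈ LinearMap.range Ψ := by
    intro a
    induction a using FreeAlgebra.induction with
    | grade0 c =>
      intro v hv
      rw [AlgHom.commutes, ← Algebra.smul_def]
      exact Submodule.smul_mem _ _ hv
    | grade1 z =>
      refine hleft _ fun b α => ?_
      rcases z with a | ⟨ν, k⟩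
      · change presentedCoeff x y δ a * _ ∈ _
        rw [← mul_assoc, ← map_mul]
        exact hmem _ _
      · change presentedDelta x y δ ν k * _ ∈ _
        rw [← mul_assoc, hleib, Finset.sum_mul]
        refine Submodule.sum_mem _ fun q _ => ?_
        rw [mul_assoc, mul_multi _ (presentedDelta_iterate x y δ), mul_smul_comm]
        exact nsmul_mem (hmem _ _) _
    | mul a b ha hb =>
      intro v hv
      rw [map_mul, mul_assoc]
      exact ha _ (hb v hv)
    | add a b ha hb =>
      intro v hv
      rw [map_add, add_mul]
      exact Submodule.add_mem _ (ha v hv) (hb v hv)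
  intro w
  obtain ⟨a, rfl⟩ := RingQuot.mkAlgHom_surjective K (Rel x y δ) w
  have h := key a 1 hone
  rwa [mul_one] at h

/-- The relations hold for the operators `δ ν k`. -/
theorem lift_rel (hx : ∀ D : Derivation K B B, (∀ ν, D (x ν) = 0) → D = 0)
    (hδ : ∀ ν, IsPartial x ν (δ ν)) ⦃a b : FreeAlgebra K (B ⊕ N × ℕ)⦄ (h : Rel x y δ a b) :
    FreeAlgebra.lift K (Sum.elim (fun a => Algebra.lmul K B a) fun q => δ q.1 q.2) a =
      FreeAlgebra.lift K (Sum.elim (fun a => Algebra.lmul K B a) fun q => δ q.1 q.2) b := by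
  have hleib := fun ν (b : B) k => (hδ ν).mul_lmul k b
  cases h with
  | coeff_add a b => simp [coeffGen]
  | coeff_mul a b => simp only [coeffGen, map_mul, FreeAlgebra.lift_ι_apply, Sum.elim_inl]
  | coeff_scalar c =>
    simp only [coeffGen, FreeAlgebra.lift_ι_apply, Sum.elim_inl, AlgHom.commutes]
  | delta_zero ν => simp [deltaGen, (hδ ν).zero]
  | delta_comm ν μ k l hk hl =>
    simp only [deltaGen, map_sub, map_mul, map_zero, FreeAlgebra.lift_ι_apply, Sum.elim_inr]
    exact sub_eq_zero.2 ((hδ ν).commute hx (hδ μ) k l).eq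
  | delta_iterate ν k l hk hl =>
    simp only [deltaGen, map_mul, map_nsmul, FreeAlgebra.lift_ι_apply, Sum.elim_inr]
    exact ((hδ ν).isIterative hx).iterate k l
  | delta_x ν μ k hk =>
    obtain ⟨k, rfl⟩ : ∃ k', k = k' + 1 := ⟨k - 1, by omega⟩
    simp only [deltaGen, coeffGen, map_sub, map_mul, apply_ite (FreeAlgebra.lift K _), map_zero,
      FreeAlgebra.lift_ι_apply, Sum.elim_inr, Sum.elim_inl, Nat.add_sub_cancel]
    rw [hleib, sum_antidiagonal_eq_add_sum_Icc (fun a b => Algebra.lmul K B (δ ν a (x μ)) * δ ν b),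
      (hδ ν).zero, Module.End.one_apply, add_sub_cancel_left, Finset.sum_eq_single 1]
    · rw [(hδ ν).first, Nat.add_sub_cancel]
      split_ifs
      · rw [map_one, one_mul]
      · rw [map_zero, zero_mul]
    · intro t ht h1
      rw [(hδ ν).higher _ _ (by have := Finset.mem_Icc.1 ht; omega), map_zero, zero_mul]
    · exact fun h => (h (Finset.mem_Icc.2 (by omega))).elim
  | delta_y ν s k hk =>
    simp only [deltaGen, coeffGen, map_sub, map_mul, map_sum,
      FreeAlgebra.lift_ι_apply, Sum.elim_inr, Sum.elim_inl]
    rw [hleib, sum_antidiagonal_eq_add_sum_Icc (fun a b => Algebra.lmul K B (δ ν a (y s)) * δ ν b),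
      (hδ ν).zero, Module.End.one_apply, add_sub_cancel_left]

theorem adjoin_eq_diffOps (hx : ∀ D : Derivation K B B, (∀ ν, D (x ν) = 0) → D = 0)
    (hδ : ∀ ν, IsPartial x ν (δ ν)) :
    Algebra.adjoin K (Set.range (Algebra.lmul K B) ∪
        Set.range (fun q : N × ℕ => δ q.1 q.2)) = diffOps K B := by
  refine le_antisymm (Algebra.adjoin_le ?_) (diffOps_le hx hδ ?_ ?_)
  · rintro _ (⟨b, rfl⟩ | ⟨q, rfl⟩)
    · exact ⟨0, b, rfl⟩
    · exact (hδ q.1).mem_diffOps q.2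
  · exact fun b => Algebra.subset_adjoin (Or.inl ⟨b, rfl⟩)
  · exact fun ν k => Algebra.subset_adjoin (Or.inr ⟨(ν, k), rfl⟩)

/-- An element of the kernel can be written in normal form; its image is the same normal form in
actual operators, where the coefficients are unique. -/
theorem exists_presented_equiv (hx : ∀ D : Derivation K B B, (∀ ν, D (x ν) = 0) → D = 0)
    (hδ : ∀ ν, IsPartial x ν (δ ν))
    (hgen : ∀ W : Subalgebra K B, (∀ ν, x ν ∈ W) → (∀ s, y s ∈ W) →
      (∀ a b, a * b = 1 → a ∈ W → b ∈ W) → W = ⊤) :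
    ∃ e : Presented x y δ ≃ₐ[K] diffOps K B,
      (∀ b : B, (e (RingQuot.mkAlgHom K _ (coeffGen K N b)) : Module.End K B) =
        Algebra.lmul K B b) ∧
      ∀ (ν : N) (k : ℕ),
        (e (RingQuot.mkAlgHom K _ (deltaGen K B ν k)) : Module.End K B) = δ ν k := by
  have hc : ∀ ν μ k l, Commute (δ ν k) (δ μ l) := fun ν μ => (hδ ν).commute hx (hδ μ)
  let Φ : Presented x y δ →ₐ[K] Module.End K B :=
    RingQuot.liftAlgHom K ⟨_, lift_rel (y := y) hx hδ⟩
  have hΦc : ∀ b, Φ (RingQuot.mkAlgHom K _ (coeffGen K N b)) = Algebra.lmul K B b := fun b => by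
    simp only [Φ, RingQuot.liftAlgHom_mkAlgHom_apply, coeffGen, FreeAlgebra.lift_ι_apply,
      Sum.elim_inl]
  have hΦd : ∀ ν k, Φ (RingQuot.mkAlgHom K _ (deltaGen K B ν k)) = δ ν k := fun ν k => by
    simp only [Φ, RingQuot.liftAlgHom_mkAlgHom_apply, deltaGen, FreeAlgebra.lift_ι_apply,
      Sum.elim_inr]
  have hinj : Function.Injective Φ := by
    rw [injective_iff_map_eq_zero]
    intro w hw
    obtain ⟨c, rfl⟩ := normalForm_presented_surjective hδ hgen w
    rw [map_normalForm] at hw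
    have h1 : Φ.comp (presentedCoeff x y δ) = Algebra.lmul K B := AlgHom.ext hΦc
    have h2 : (fun ν k => Φ (presentedDelta x y δ ν k)) = δ := funext₂ hΦd
    have h3 : normalForm (Algebra.lmul K B) δ hc c = 0 := by
      rw [← hw]
      congr 1
      simp only [h1, h2]
    rw [(injective_iff_map_eq_zero _).1 (normalForm_injective hδ hc) c h3, map_zero]
  have hrange : Φ.range = diffOps K B := by
    rw [← adjoin_eq_diffOps hx hδ]
    refine le_antisymm ?_ (Algebra.adjoin_le ?_)
    · rintro _ ⟨w, rfl⟩
      obtain ⟨a, rfl⟩ := RingQuot.mkAlgHom_surjective K (Rel x y δ) w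
      change Φ (RingQuot.mkAlgHom K _ a) ∈ _
      induction a using FreeAlgebra.induction with
      | grade0 c =>
        rw [AlgHom.commutes, AlgHom.commutes]
        exact Subalgebra.algebraMap_mem _ c
      | grade1 z =>
        rcases z with b | ⟨ν, k⟩
        · exact (hΦc b).symm ▸ Algebra.subset_adjoin (Or.inl ⟨b, rfl⟩)
        · exact (hΦd ν k).symm ▸ Algebra.subset_adjoin (Or.inr ⟨(ν, k), rfl⟩)
      | mul a b ha hb =>
        rw [map_mul, map_mul]
        exact Subalgebra.mul_mem _ ha hb
      | add a b ha hb =>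
        rw [map_add, map_add]
        exact Subalgebra.add_mem _ ha hb
    · rintro _ (⟨b, rfl⟩ | ⟨q, rfl⟩)
      · exact ⟨_, hΦc b⟩
      · exact ⟨_, hΦd q.1 q.2⟩
  exact ⟨(AlgEquiv.ofInjective Φ hinj).trans (Subalgebra.equivOfEq _ _ hrange), hΦc, hΦd⟩

end Presentation

/-! ### Derivations and tangent vectors where the minor is invertible -/

section JacobiDerivations

variable {K L : Type*} [CommRing K] [CommRing L] [Algebra K L] {m n r : ℕ}

theorem derivation_apply_eq_sum {M : Type*} [AddCommGroup M] [Module L M] [Module K M]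
    (π : MvPolynomial (Fin n) K →ₐ[K] L) (D : Derivation K L M) (g : MvPolynomial (Fin n) K) :
    D (π g) = ∑ l, π (MvPolynomial.pderiv l g) • D (π (MvPolynomial.X l)) := by
  induction g using MvPolynomial.induction_on with
  | C c =>
    have : π (MvPolynomial.C c) = algebraMap K L c := π.commutes c
    simp [this]
  | add p q hp hq => simp only [map_add, hp, hq, add_smul, Finset.sum_add_distrib]
  | mul_X p t hp =>
    have : ∑ l, (π p * π (MvPolynomial.pderiv l (MvPolynomial.X t))) • D (π (MvPolynomial.X l)) =
        π p • D (π (MvPolynomial.X t)) := by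
      rw [Finset.sum_eq_single t]
      · simp
      · intro l _ hl
        simp [MvPolynomial.pderiv_X, Pi.single_eq_of_ne hl.symm]
      · simp
    simp only [map_mul, Derivation.leibniz, smul_eq_mul, map_add, add_smul, Finset.sum_add_distrib,
      this, hp, Finset.smul_sum]
    congr 1
    exact Finset.sum_congr rfl fun l _ => by rw [smul_smul]

theorem sum_eq_sum_range_add_sum_freeIndex {M : Type*} [AddCommMonoid M] (j : Fin r ↪o Fin n)
    [Fintype (FreeIndex j)] (F : Fin n → M) :
    ∑ l, F l = ∑ s, F (j s) + ∑ ν : FreeIndex j, F ν := by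
  classical
  rw [← Fintype.sum_subtype_add_sum_subtype (fun l => l ∈ Set.range j) F]
  congr 1
  · refine Eq.trans ?_ (Fintype.sum_equiv (Equiv.ofInjective j j.injective) (fun s => F (j s))
      (fun l => F l) fun _ => rfl).symm
    congr!
  · congr!

/-- Where the minor `Δ(i, j)` is invertible, a derivation is determined by its values at the
coordinates outside `{j_1, …, j_r}`. -/
theorem derivation_eq_zero {M : Type*} [AddCommGroup M] [Module L M] [Module K M]
    (π : MvPolynomial (Fin n) K →ₐ[K] L)
    (hgen : ∀ b, ∃ g h, IsUnit (π h) ∧ b * π h = π g)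
    {f : Fin m → MvPolynomial (Fin n) K} (hf : ∀ a, π (f a) = 0)
    {i : Fin r ↪o Fin m} {j : Fin r ↪o Fin n}
    (hΔ : IsUnit (jacobiMinor (π : MvPolynomial (Fin n) K →+* L) f i j))
    (D : Derivation K L M) (hD : ∀ ν : FreeIndex j, D (π (MvPolynomial.X ν)) = 0) : D = 0 := by
  classical
  set A := (jacobiMatrix (π : MvPolynomial (Fin n) K →+* L) f).submatrix i j with hA
  have h1 : ∀ a, ∑ s, A a s • D (π (MvPolynomial.X (j s))) = 0 := by
    intro a
    have h := derivation_apply_eq_sum π D (f (i a))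
    rw [hf, map_zero, sum_eq_sum_range_add_sum_freeIndex j] at h
    simp only [hD, smul_zero, Finset.sum_const_zero, add_zero] at h
    exact h.symm
  have h2 : ∀ t, D (π (MvPolynomial.X (j t))) = 0 := by
    intro t
    -- The equations `D (f_{i_a}) = 0` form a linear system with matrix `A` for the values at the
    -- dependent coordinates.
    have h3 : ∑ a, A⁻¹ t a • ∑ s, A a s • D (π (MvPolynomial.X (j s))) = 0 := by simp [h1]
    have h4 : ∑ a, A⁻¹ t a • ∑ s, A a s • D (π (MvPolynomial.X (j s))) =
        ∑ s, (A⁻¹ * A) t s • D (π (MvPolynomial.X (j s))) := by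
      simp only [Finset.smul_sum, smul_smul, Matrix.mul_apply, Finset.sum_smul]
      exact Finset.sum_comm
    rw [h4, Matrix.nonsing_inv_mul A hΔ] at h3
    simpa [Matrix.one_apply] using h3
  have h5 : ∀ g, D (π g) = 0 := by
    intro g
    rw [derivation_apply_eq_sum, sum_eq_sum_range_add_sum_freeIndex j]
    simp [hD, h2]
  ext b
  obtain ⟨g, h, hu, hb⟩ := hgen b
  have h6 := congrArg D hb
  rw [Derivation.leibniz, h5, h5, smul_zero, zero_add] at h6
  exact hu.smul_eq_zero.1 h6

/-- A tangent vector with prescribed coordinates outside `{j_1, …, j_r}`. -/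
theorem exists_tangent {K L : Type*} [CommRing K] [CommRing L] (φ : MvPolynomial (Fin n) K →+* L)
    {f : Fin m → MvPolynomial (Fin n) K} {i : Fin r ↪o Fin m} {j : Fin r ↪o Fin n}
    (hΔ : IsUnit (jacobiMinor φ f i j)) {c : Matrix (Fin m) (Fin r) L}
    (hc : jacobiMatrix φ f = c * (jacobiMatrix φ f).submatrix i id) (ν : FreeIndex j) :
    ∃ v : Fin n → L, (jacobiMatrix φ f).mulVec v = 0 ∧
      ∀ μ : FreeIndex j, v μ = if ν = μ then 1 else 0 := by
  classical
  set J := jacobiMatrix φ f with hJ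
  set A := J.submatrix i j with hA
  -- The dependent entries are forced by the rows `i`; the other rows then impose nothing new, by
  -- `hc`.
  set w : Fin r → L := -(A⁻¹.mulVec fun a => J (i a) ν) with hw
  set v : Fin n → L := Function.extend j w (fun l => if ν = l then 1 else 0) with hv
  have hvj : ∀ s, v (j s) = w s := fun s => j.injective.extend_apply _ _ _
  have hvf : ∀ μ : FreeIndex j, v μ = if ν = μ then 1 else 0 := by
    intro μ
    rw [hv, Function.extend_apply' _ _ _ (fun ⟨s, hs⟩ => μ.2 ⟨s, hs⟩)]
    simp only [Subtype.ext_iff]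
  refine ⟨v, ?_, hvf⟩
  have h1 : (J.submatrix i id).mulVec v = 0 := by
    ext a
    have h2 : A.mulVec w = -fun a => J (i a) ν := by
      rw [hw, Matrix.mulVec_neg, Matrix.mulVec_mulVec, Matrix.mul_nonsing_inv A hΔ,
        Matrix.one_mulVec]
    have h3 : ∑ s, J (i a) (j s) * w s = -J (i a) ν := congrFun h2 a
    change ∑ l, J (i a) l * v l = 0
    rw [sum_eq_sum_range_add_sum_freeIndex j]
    simp only [hvj, hvf, h3]
    simp
  rw [hc, ← Matrix.mulVec_mulVec, h1, Matrix.mulVec_zero]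

end JacobiDerivations

/-! ### The function field is formally étale over the free coordinates -/

section FunctionField

variable {K Q : Type*} [Field K] [Field Q] [Algebra K Q] {m n : ℕ}

theorem isFractionRing_quotient_ker (π : MvPolynomial (Fin n) K →ₐ[K] Q)
    (hgen : ∀ q, ∃ g h, π h ≠ 0 ∧ q * π h = π g) :
    letI := (Ideal.kerLiftAlg π).toRingHom.toAlgebra
    IsFractionRing (MvPolynomial (Fin n) K ⧸ RingHom.ker π) Q := by
  let _ := (Ideal.kerLiftAlg π).toRingHom.toAlgebra
  have : FaithfulSMul (MvPolynomial (Fin n) K ⧸ RingHom.ker π) Q :=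
    (faithfulSMul_iff_algebraMap_injective _ _).2 (Ideal.kerLiftAlg_injective π)
  refine IsFractionRing.of_field _ _ fun q => ?_
  obtain ⟨g, h, hh, hq⟩ := hgen q
  exact ⟨Ideal.Quotient.mk _ g, Ideal.Quotient.mk _ h, (eq_div_iff hh).2 hq⟩

/-- A finitely generated extension of a perfect field is separable, hence formally smooth. -/
theorem formallySmooth_of_perfectField [PerfectField K] (π : MvPolynomial (Fin n) K →ₐ[K] Q)
    (hgen : ∀ q, ∃ g h, π h ≠ 0 ∧ q * π h = π g) : Algebra.FormallySmooth K Q := by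
  let _ := (Ideal.kerLiftAlg π).toRingHom.toAlgebra
  have : IsScalarTower K (MvPolynomial (Fin n) K ⧸ RingHom.ker π) Q :=
    IsScalarTower.of_algebraMap_eq' (Ideal.kerLiftAlg π).comp_algebraMap.symm
  have := isFractionRing_quotient_ker π hgen
  have : Algebra.EssFiniteType (MvPolynomial (Fin n) K ⧸ RingHom.ker π) Q :=
    Algebra.EssFiniteType.of_isLocalization Q
      (nonZeroDivisors (MvPolynomial (Fin n) K ⧸ RingHom.ker π))
  have : Algebra.EssFiniteType K Q :=
    Algebra.EssFiniteType.comp K (MvPolynomial (Fin n) K ⧸ RingHom.ker π) Q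
  infer_instance

/-- A tangent vector at the generic point extends to a derivation of the function field. -/
theorem exists_derivation (π : MvPolynomial (Fin n) K →ₐ[K] Q)
    (hgen : ∀ q, ∃ g h, π h ≠ 0 ∧ q * π h = π g) {f : Fin m → MvPolynomial (Fin n) K}
    (hker : RingHom.ker π = Ideal.span (Set.range f)) (v : Fin n → Q)
    (hv : (jacobiMatrix (π : MvPolynomial (Fin n) K →+* Q) f).mulVec v = 0) :
    ∃ D : Derivation K Q Q, ∀ l, D (π (MvPolynomial.X l)) = v l := by
  -- This is `x_l ↦ x_l + ε v_l`. The `ε`-part of the image of `f_a` is the `a`-th entry of the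
  -- Jacobi matrix times `v`, so `ψ` factors through the quotient and then through its fraction
  -- field.
  let ψ : MvPolynomial (Fin n) K →ₐ[K] DualNumber Q :=
    MvPolynomial.aeval fun l => TrivSqZeroExt.inl (π (MvPolynomial.X l)) + TrivSqZeroExt.inr (v l)
  have hψX : ∀ l, ψ (MvPolynomial.X l) =
      TrivSqZeroExt.inl (π (MvPolynomial.X l)) + TrivSqZeroExt.inr (v l) := fun l => by simp [ψ]
  have hfst : ∀ g, (ψ g).fst = π g := by
    intro g
    have : (TrivSqZeroExt.fstHom K Q Q).comp ψ = π := by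
      ext l
      simp [hψX]
    exact DFunLike.congr_fun this g
  have hsnd : ∀ g, (ψ g).snd = ∑ l, π (MvPolynomial.pderiv l g) * v l := by
    intro g
    induction g using MvPolynomial.induction_on with
    | C c =>
      have : ψ (MvPolynomial.C c) = algebraMap K _ c := ψ.commutes c
      simp [this, TrivSqZeroExt.algebraMap_eq_inl']
    | add p q hp hq => simp [hp, hq, add_mul, Finset.sum_add_distrib]
    | mul_X p t hp =>
      have : ∑ l, (π p * π (MvPolynomial.pderiv l (MvPolynomial.X t))) * v l = π p * v t := by
        rw [Finset.sum_eq_single t]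
        · simp
        · intro l _ hl
          simp [MvPolynomial.pderiv_X, Pi.single_eq_of_ne hl.symm]
        · simp
      rw [map_mul, TrivSqZeroExt.snd_mul, hfst, hp, hfst, hψX]
      simp only [Derivation.leibniz, smul_eq_mul, map_add, map_mul, add_mul,
        Finset.sum_add_distrib, this]
      simp [Finset.mul_sum, mul_comm, mul_left_comm]
  have hψker : ∀ g ∈ RingHom.ker π, ψ g = 0 := by
    intro g hg
    have hle : Ideal.span (Set.range f) ≤ RingHom.ker ψ := by
      rw [Ideal.span_le]
      rintro _ ⟨a, rfl⟩
      refine TrivSqZeroExt.ext ?_ ?_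
      · rw [hfst]
        exact (hker ▸ Ideal.subset_span ⟨a, rfl⟩ : f a ∈ RingHom.ker π)
      · rw [hsnd]
        exact congrFun hv a
    exact hle (hker ▸ hg)
  let _ := (Ideal.kerLiftAlg π).toRingHom.toAlgebra
  have : IsScalarTower K (MvPolynomial (Fin n) K ⧸ RingHom.ker π) Q :=
    IsScalarTower.of_algebraMap_eq' (Ideal.kerLiftAlg π).comp_algebraMap.symm
  have := isFractionRing_quotient_ker π hgen
  let ψ' : MvPolynomial (Fin n) K ⧸ RingHom.ker π →ₐ[K] DualNumber Q :=
    Ideal.Quotient.liftₐ (RingHom.ker π) ψ hψker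
  have hfst' : ∀ z, (ψ' z).fst = algebraMap _ Q z := by
    intro z
    obtain ⟨g, rfl⟩ := Ideal.Quotient.mk_surjective z
    exact hfst g
  let Φ : Q →ₐ[K] DualNumber Q := IsLocalization.liftAlgHom
    (M := nonZeroDivisors (MvPolynomial (Fin n) K ⧸ RingHom.ker π)) (f := ψ') (by
      intro z
      rw [TrivSqZeroExt.isUnit_iff_isUnit_fst, hfst']
      exact IsLocalization.map_units Q z)
  have hΦ : ∀ z, Φ (algebraMap (MvPolynomial (Fin n) K ⧸ RingHom.ker π) Q z) = ψ' z := fun z =>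
    IsLocalization.lift_eq _ z
  have hΦfst : ∀ q, (Φ q).fst = q := by
    intro q
    have h1 : (TrivSqZeroExt.fstHom K Q Q).comp Φ = AlgHom.id K Q :=
      IsLocalization.algHom_ext (nonZeroDivisors (MvPolynomial (Fin n) K ⧸ RingHom.ker π))
        (by
          ext z
          exact (congrArg TrivSqZeroExt.fst (hΦ _)).trans (hfst' _))
    exact DFunLike.congr_fun h1 _
  refine ⟨Derivation.mk' ((TrivSqZeroExt.sndHom Q Q).restrictScalars K ∘ₗ Φ.toLinearMap) ?_, ?_⟩
  · intro a b
    simp [TrivSqZeroExt.snd_mul, hΦfst, mul_comm]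
  · intro l
    have h1 : Φ (π (MvPolynomial.X l)) = ψ (MvPolynomial.X l) :=
      hΦ (Ideal.Quotient.mk _ (MvPolynomial.X l))
    simp [h1, hψX]

/-- A formally smooth extension for which the differentials of given elements form a basis is
formally étale over the polynomial ring in these elements. -/
theorem formallyEtale_of_derivations {N : Type*} [DecidableEq N] [Algebra.FormallySmooth K Q]
    [Algebra (MvPolynomial N K) Q] [IsScalarTower K (MvPolynomial N K) Q]
    (hzero : ∀ D : Derivation K Q (Ω[Q⁄MvPolynomial N K]),
      (∀ ν, D (algebraMap (MvPolynomial N K) Q (MvPolynomial.X ν)) = 0) → D = 0)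
    (hder : ∀ ν, ∃ D : Derivation K Q Q,
      ∀ μ, D (algebraMap (MvPolynomial N K) Q (MvPolynomial.X μ)) = if ν = μ then 1 else 0) :
    Algebra.FormallyEtale (MvPolynomial N K) Q := by
  have hinj : Function.Injective (KaehlerDifferential.mapBaseChange K (MvPolynomial N K) Q) := by
    rw [injective_iff_map_eq_zero]
    intro z hz
    let b := (KaehlerDifferential.mvPolynomialBasis K N).baseChange Q
    refine b.forall_coord_eq_zero_iff.1 fun ν => ?_
    obtain ⟨D, hD⟩ := hder ν
    -- The given derivations, read on differentials, are the coordinate functionals of the basis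
    -- `dX_ν`; so these factor through `mapBaseChange`.
    have h1 : b.coord ν = D.liftKaehlerDifferential ∘ₗ
        KaehlerDifferential.mapBaseChange K (MvPolynomial N K) Q := by
      refine b.ext fun μ => ?_
      simp [b, KaehlerDifferential.mvPolynomialBasis_apply, hD, Finsupp.single_apply, eq_comm]
    rw [h1, LinearMap.comp_apply, hz, map_zero]
  refine ⟨?_, ?_⟩
  · have h0 := hzero ((KaehlerDifferential.D (MvPolynomial N K) Q).restrictScalars K)
      fun ν => (KaehlerDifferential.D (MvPolynomial N K) Q).map_algebraMap _
    have h1 : (⊤ : Submodule Q (Ω[Q⁄MvPolynomial N K])) = ⊥ := by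
      rw [← KaehlerDifferential.span_range_derivation, Submodule.span_eq_bot]
      rintro _ ⟨q, rfl⟩
      exact DFunLike.congr_fun h0 q
    exact (Submodule.subsingleton_iff Q).1 (subsingleton_of_bot_eq_top h1.symm)
  -- In the Jacobi–Zariski sequence `H1Cotangent` of `Q` over the polynomial ring lies between that
  -- of `Q` over `K`, which is zero by formal smoothness, and the kernel of `mapBaseChange`, which
  -- is zero by `hinj`.
  · refine ⟨fun a b => ?_⟩
    have h0 : ∀ c : Algebra.H1Cotangent (MvPolynomial N K) Q, c = 0 := fun c => by
      have h1 : KaehlerDifferential.mapBaseChange K (MvPolynomial N K) Q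
          (Algebra.H1Cotangent.δ K (MvPolynomial N K) Q c) = 0 :=
        (Algebra.H1Cotangent.exact_δ_mapBaseChange K (MvPolynomial N K) Q _).2 ⟨c, rfl⟩
      obtain ⟨e, rfl⟩ := (Algebra.H1Cotangent.exact_map_δ K (MvPolynomial N K) Q c).1
        ((injective_iff_map_eq_zero _).1 hinj _ h1)
      rw [Subsingleton.elim e 0, map_zero]
    rw [h0 a, h0 b]

/-- The `R`-algebra structure on `S` comes from `ρ`. In the application this is the translated
structure on `Q⟦X⟧`, not the one given by constant series. -/
theorem exists_lift_of_formallySmooth {R A S : Type*} [CommRing R] [CommRing A] [Algebra R A]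
    [Algebra.FormallySmooth R A] [CommRing S] (I : Ideal S) [IsAdicComplete I S] (ρ : R →+* S)
    (g : A →+* S ⧸ I) (h : ∀ a, g (algebraMap R A a) = Ideal.Quotient.mk I (ρ a)) :
    ∃ σ : A →+* S, (∀ a, Ideal.Quotient.mk I (σ a) = g a) ∧
      ∀ a, σ (algebraMap R A a) = ρ a := by
  let _ := ρ.toAlgebra
  let g' : A →ₐ[R] S ⧸ I := { g with commutes' := h }
  obtain ⟨σ, hσ⟩ := Algebra.FormallySmooth.exists_mkₐ_comp_eq_of_isAdicComplete g'
  exact ⟨σ, fun a => DFunLike.congr_fun hσ a, fun a => σ.commutes a⟩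

end FunctionField

/-! ### Coefficients stay in the smaller ring -/

section Descent

variable {K B Q : Type*} [CommRing K] [CommRing B] [CommRing Q] [Algebra B Q] {m n r : ℕ}

/-- The top coefficient of the value of a series of operators at a polynomial, modulo an
expression in lower coefficients. -/
theorem coeff_sub_sum_mem (T : Subring Q) (φ : MvPolynomial (Fin n) K →+* Q)
    (τ : MvPolynomial (Fin n) K →+* Q⟦X⟧) (hτ0 : ∀ g, constantCoeff (τ g) = φ g)
    (hτC : ∀ c, τ (MvPolynomial.C c) = C (φ (MvPolynomial.C c)))
    (hφ : ∀ g, φ g ∈ T) {k : ℕ} (hk : k ≠ 0)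
    (hlt : ∀ l, ∀ t < k, coeff t (τ (MvPolynomial.X l)) ∈ T) (g : MvPolynomial (Fin n) K) :
    (∀ t < k, coeff t (τ g) ∈ T) ∧
      coeff k (τ g) - ∑ l, φ (MvPolynomial.pderiv l g) * coeff k (τ (MvPolynomial.X l)) ∈ T := by
  induction g using MvPolynomial.induction_on with
  | C c =>
    refine ⟨fun t _ => ?_, ?_⟩
    · rw [hτC, coeff_C]
      split_ifs
      exacts [hφ _, T.zero_mem]
    · rw [hτC, coeff_C, if_neg hk]
      simp [T.zero_mem]
  | add p q hp hq =>
    refine ⟨fun t ht => ?_, ?_⟩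
    · rw [map_add, map_add]
      exact T.add_mem (hp.1 t ht) (hq.1 t ht)
    · convert T.add_mem hp.2 hq.2 using 1
      simp only [map_add, add_mul, Finset.sum_add_distrib]
      ring
  | mul_X p s hp =>
    refine ⟨fun t ht => ?_, ?_⟩
    · rw [map_mul, coeff_mul]
      refine T.sum_mem fun q hq => ?_
      have hq' := Finset.HasAntidiagonal.mem_antidiagonal.1 hq
      exact T.mul_mem (hp.1 _ (by omega)) (hlt _ _ (by omega))
    · have h0k : ((0, k) : ℕ × ℕ) ∈ Finset.HasAntidiagonal.antidiagonal k :=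
        Finset.HasAntidiagonal.mem_antidiagonal.2 (zero_add k)
      have hk0 : ((k, 0) : ℕ × ℕ) ∈ (Finset.HasAntidiagonal.antidiagonal k).erase (0, k) :=
        Finset.mem_erase.2 ⟨fun h => hk (Prod.ext_iff.1 h).1,
          Finset.HasAntidiagonal.mem_antidiagonal.2 (add_zero k)⟩
      have h1 : ∑ l, (φ p * φ (MvPolynomial.pderiv l (MvPolynomial.X s))) *
          coeff k (τ (MvPolynomial.X l)) = φ p * coeff k (τ (MvPolynomial.X s)) := by
        rw [Finset.sum_eq_single s]
        · simp
        · intro l _ hl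
          simp [MvPolynomial.pderiv_X, Pi.single_eq_of_ne hl.symm]
        · simp
      rw [map_mul, coeff_mul, ← Finset.add_sum_erase _ _ h0k, ← Finset.add_sum_erase _ _ hk0]
      simp only [coeff_zero_eq_constantCoeff, hτ0, Derivation.leibniz, smul_eq_mul, map_add,
        map_mul, add_mul, Finset.sum_add_distrib, h1]
      -- Once the terms `(0, k)` and `(k, 0)` are split off, only coefficients of index below `k`
      -- occur.
      have h2 : ∑ q ∈ ((Finset.HasAntidiagonal.antidiagonal k).erase (0, k)).erase (k, 0),
          coeff q.1 (τ p) * coeff q.2 (τ (MvPolynomial.X s)) ∈ T := by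
        refine T.sum_mem fun q hq => ?_
        obtain ⟨hq1, hq2, hq3⟩ : q ≠ (k, 0) ∧ q ≠ (0, k) ∧ q.1 + q.2 = k := by
          simpa using hq
        have hlt1 : q.1 ≠ k := fun h => hq1 (Prod.ext h (by simp; omega))
        have hlt2 : q.2 ≠ k := fun h => hq2 (Prod.ext (by simp; omega) h)
        exact T.mul_mem (hp.1 _ (by omega)) (hlt _ _ (by omega))
      convert T.add_mem (T.mul_mem hp.2 (hφ (MvPolynomial.X s))) h2 using 1
      have h3 : ∑ l, φ (MvPolynomial.X s) * φ (MvPolynomial.pderiv l p) *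
          coeff k (τ (MvPolynomial.X l)) = (∑ l, φ (MvPolynomial.pderiv l p) *
            coeff k (τ (MvPolynomial.X l))) * φ (MvPolynomial.X s) := by
        rw [Finset.sum_mul]
        exact Finset.sum_congr rfl fun l _ => by ring
      rw [h3]
      ring

/-- A series of operators defined over the larger ring `Q` takes the coordinate functions to series
over `B` as soon as it does so for those outside `{j_1, …, j_r}` and the minor `Δ(i, j)` is
invertible in `B`. -/
theorem coeff_mem_range (φ : MvPolynomial (Fin n) K →+* B)
    (τ : MvPolynomial (Fin n) K →+* Q⟦X⟧)
    (hτ0 : ∀ g, constantCoeff (τ g) = algebraMap B Q (φ g))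
    (hτC : ∀ c, τ (MvPolynomial.C c) = C (algebraMap B Q (φ (MvPolynomial.C c))))
    {f : Fin m → MvPolynomial (Fin n) K} (hτf : ∀ a, τ (f a) = 0)
    {i : Fin r ↪o Fin m} {j : Fin r ↪o Fin n} (hΔ : IsUnit (jacobiMinor φ f i j))
    (hfree : ∀ (ν : FreeIndex j) k, coeff k (τ (MvPolynomial.X ν)) ∈ (algebraMap B Q).range)
    (k : ℕ) (g : MvPolynomial (Fin n) K) : coeff k (τ g) ∈ (algebraMap B Q).range := by
  classical
  set T := (algebraMap B Q).range
  set A := (jacobiMatrix φ f).submatrix i j with hA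
  have hφ : ∀ g, (algebraMap B Q).comp φ g ∈ T := fun g => ⟨φ g, rfl⟩
  have hX : ∀ k l, coeff k (τ (MvPolynomial.X l)) ∈ T := by
    intro k
    induction k using Nat.strong_induction_on with
    | _ k ih =>
      rcases Nat.eq_zero_or_pos k with rfl | hk
      · intro l
        rw [coeff_zero_eq_constantCoeff_apply, hτ0]
        exact ⟨_, rfl⟩
      -- The coefficient of `t^k` in `τ (f (i a)) = 0`, modulo `T`, is linear in the `k`-th
      -- coefficients of the coordinates. The free ones lie in `T`, which leaves a system with the
      -- invertible matrix `A`.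
      have h1 : ∀ a, ∑ s, algebraMap B Q (A a s) * coeff k (τ (MvPolynomial.X (j s))) ∈ T := by
        intro a
        have h := (coeff_sub_sum_mem T ((algebraMap B Q).comp φ) τ hτ0 hτC hφ hk.ne'
          (fun l t ht => ih t ht l) (f (i a))).2
        rw [hτf, map_zero, zero_sub, sum_eq_sum_range_add_sum_freeIndex j] at h
        have h2 : ∑ ν : FreeIndex j, (algebraMap B Q).comp φ (MvPolynomial.pderiv ν.1 (f (i a))) *
            coeff k (τ (MvPolynomial.X ν.1)) ∈ T :=
          T.sum_mem fun ν _ => T.mul_mem (hφ _) (hfree ν k)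
        convert T.sub_mem (T.neg_mem h) h2 using 1
        rw [neg_neg, add_sub_cancel_right]
        rfl
      choose e he using h1
      have h2 : ∀ t, coeff k (τ (MvPolynomial.X (j t))) = algebraMap B Q (A⁻¹.mulVec e t) := by
        intro t
        have h3 : ∑ a, algebraMap B Q (A⁻¹ t a) * ∑ s, algebraMap B Q (A a s) *
              coeff k (τ (MvPolynomial.X (j s))) =
            ∑ s, algebraMap B Q ((A⁻¹ * A) t s) * coeff k (τ (MvPolynomial.X (j s))) := by
          simp only [Finset.mul_sum, Matrix.mul_apply, map_sum, map_mul, Finset.sum_mul, mul_assoc]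
          exact Finset.sum_comm
        rw [Matrix.nonsing_inv_mul A hΔ] at h3
        simp only [← he, Matrix.one_apply, apply_ite (algebraMap B Q), map_one, map_zero, ite_mul,
          one_mul, zero_mul, Finset.sum_ite_eq, Finset.mem_univ, if_true] at h3
        rw [← h3, Matrix.mulVec, dotProduct, map_sum]
        simp only [map_mul]
      intro l
      by_cases hl : l ∈ Set.range j
      · obtain ⟨t, rfl⟩ := hl
        exact ⟨_, (h2 t).symm⟩
      · exact hfree ⟨l, hl⟩ k
  -- Index `k + 1` is used because the first half covers only indices strictly below the given one.
  exact (coeff_sub_sum_mem T ((algebraMap B Q).comp φ) τ hτ0 hτC hφ k.succ_ne_zero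
    (fun l t _ => hX t l) g).1 k k.lt_succ_self

end Descent

/-! ### Existence of the higher derivations -/

section Existence

variable {K B : Type*} [Field K] [PerfectField K] [CommRing B] [IsDomain B] [Algebra K B]
  {m n r : ℕ}

/-- The automorphism `x_ν ↦ x_ν + t` of the polynomial ring in the coordinates outside
`{j_1, …, j_r}` extends to the function field. -/
theorem exists_series_functionField {Q : Type*} [Field Q] [Algebra K Q]
    (π : MvPolynomial (Fin n) K →ₐ[K] Q) (hgen : ∀ q, ∃ g h, π h ≠ 0 ∧ q * π h = π g)
    {f : Fin m → MvPolynomial (Fin n) K} (hker : RingHom.ker π = Ideal.span (Set.range f))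
    {i : Fin r ↪o Fin m} {j : Fin r ↪o Fin n}
    (hΔ : IsUnit (jacobiMinor (π : MvPolynomial (Fin n) K →+* Q) f i j))
    {c : Matrix (Fin m) (Fin r) Q}
    (hc : jacobiMatrix (π : MvPolynomial (Fin n) K →+* Q) f =
      c * (jacobiMatrix (π : MvPolynomial (Fin n) K →+* Q) f).submatrix i id)
    (ν : FreeIndex j) :
    ∃ σ : Q →+* Q⟦X⟧, (∀ q, constantCoeff (σ q) = q) ∧
      (∀ a, σ (algebraMap K Q a) = C (algebraMap K Q a)) ∧
      ∀ μ : FreeIndex j, σ (π (MvPolynomial.X μ)) =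
        C (π (MvPolynomial.X μ)) + if ν = μ then X else 0 := by
  have hf : ∀ a, π (f a) = 0 := fun a => by
    have h : f a ∈ RingHom.ker π := hker ▸ Ideal.subset_span ⟨a, rfl⟩
    exact h
  have := formallySmooth_of_perfectField π hgen
  let P' := MvPolynomial (FreeIndex j) K
  let ev : P' →ₐ[K] Q := MvPolynomial.aeval fun μ => π (MvPolynomial.X μ)
  let _ : Algebra P' Q := ev.toRingHom.toAlgebra
  have : IsScalarTower K P' Q := IsScalarTower.of_algebraMap_eq' ev.comp_algebraMap.symm
  have hX : ∀ μ, algebraMap P' Q (MvPolynomial.X μ) = π (MvPolynomial.X μ) := fun μ =>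
    MvPolynomial.aeval_X _ μ
  have : Algebra.FormallyEtale P' Q := by
    refine formallyEtale_of_derivations (fun D hD => ?_) fun μ => ?_
    · refine derivation_eq_zero π (fun q => ?_) hf hΔ D fun μ => by rw [← hX]; exact hD μ
      obtain ⟨g, h, hh, hq⟩ := hgen q
      exact ⟨g, h, isUnit_iff_ne_zero.2 hh, hq⟩
    · obtain ⟨v, hv, hvf⟩ := exists_tangent _ hΔ hc μ
      obtain ⟨D, hD⟩ := exists_derivation π hgen hker v hv
      exact ⟨D, fun κ => by rw [hX, hD, hvf]⟩
  let ρ : P' →ₐ[K] Q⟦X⟧ := MvPolynomial.aeval fun μ =>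
    C (π (MvPolynomial.X μ)) + if ν = μ then X else 0
  have hρX : ∀ μ, ρ (MvPolynomial.X μ) = C (π (MvPolynomial.X μ)) + if ν = μ then X else 0 :=
    fun μ => MvPolynomial.aeval_X _ μ
  have hρC : ∀ a, ρ (algebraMap K P' a) = C (algebraMap K Q a) := fun a =>
    (ρ.commutes a).trans (PowerSeries.algebraMap_apply ..)
  have hρ0 : ∀ g, constantCoeff (ρ g) = algebraMap P' Q g := by
    intro g
    have h : (constantCoeff (R := Q)).comp (ρ : P' →+* Q⟦X⟧) = algebraMap P' Q := by
      refine MvPolynomial.ringHom_ext (fun a => ?_) fun μ => ?_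
      · change constantCoeff (ρ (algebraMap K P' a)) = algebraMap P' Q (algebraMap K P' a)
        rw [hρC, ← IsScalarTower.algebraMap_apply]
        simp
      · change constantCoeff (ρ (MvPolynomial.X μ)) = _
        rw [hρX, hX]
        split_ifs <;> simp
    exact DFunLike.congr_fun h g
  have hmk : ∀ s : Q⟦X⟧, Ideal.Quotient.mk (Ideal.span {X}) (C (constantCoeff s)) =
      Ideal.Quotient.mk (Ideal.span {(X : Q⟦X⟧)}) s := by
    intro s
    rw [Ideal.Quotient.eq, Ideal.mem_span_singleton, X_dvd_iff]
    simp
  -- The identity of `Q = Q⟦X⟧ / (X)` is lifted along the `X`-adic filtration, compatibly with the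
  -- translation `ρ`.
  obtain ⟨σ, hσ, hσρ⟩ := exists_lift_of_formallySmooth (A := Q) (Ideal.span {(X : Q⟦X⟧)})
    (ρ : P' →+* Q⟦X⟧) ((Ideal.Quotient.mk _).comp C) (fun g => by
      rw [RingHom.comp_apply, ← hρ0, hmk]
      rfl)
  refine ⟨σ, fun q => ?_, fun a => ?_, fun μ => ?_⟩
  · have h := hσ q
    rw [RingHom.comp_apply, Ideal.Quotient.eq, Ideal.mem_span_singleton, X_dvd_iff, map_sub,
      constantCoeff_C, sub_eq_zero] at h
    exact h
  · rw [IsScalarTower.algebraMap_apply K P' Q, hσρ, ← IsScalarTower.algebraMap_apply]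
    exact hρC a
  · rw [← hX μ, hσρ, hX]
    exact hρX μ

theorem exists_isPartial (π : MvPolynomial (Fin n) K →ₐ[K] B)
    (hgen : ∀ b, ∃ g h, IsUnit (π h) ∧ b * π h = π g)
    {f : Fin m → MvPolynomial (Fin n) K} (hker : RingHom.ker π = Ideal.span (Set.range f))
    {i : Fin r ↪o Fin m} {j : Fin r ↪o Fin n}
    (hΔ : IsUnit (jacobiMinor (π : MvPolynomial (Fin n) K →+* B) f i j))
    {c : Matrix (Fin m) (Fin r) B}
    (hc : jacobiMatrix (π : MvPolynomial (Fin n) K →+* B) f =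
      c * (jacobiMatrix (π : MvPolynomial (Fin n) K →+* B) f).submatrix i id)
    (ν : FreeIndex j) :
    ∃ d : ℕ → Module.End K B, IsPartial (fun μ : FreeIndex j => π (MvPolynomial.X μ)) ν d := by
  let Q := FractionRing B
  let ι : B →ₐ[K] Q := IsScalarTower.toAlgHom K B Q
  have hι : Function.Injective ι := IsFractionRing.injective B Q
  have hmap : Function.Injective (PowerSeries.map (algebraMap B Q)) := fun s t h => by
    ext k
    apply hι
    have h' := congrArg (coeff k) h
    rw [coeff_map, coeff_map] at h'
    exact h'
  let πQ : MvPolynomial (Fin n) K →ₐ[K] Q := ι.comp π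
  have hgenQ : ∀ q, ∃ g h, πQ h ≠ 0 ∧ q * πQ h = πQ g := by
    intro q
    obtain ⟨a, b, hb, rfl⟩ := IsFractionRing.div_surjective (A := B) q
    have hb0 : b ≠ 0 := nonZeroDivisors.ne_zero hb
    obtain ⟨g, h, hu, hg⟩ := hgen a
    obtain ⟨g', h', hu', hg'⟩ := hgen b
    have hbQ : algebraMap B Q b ≠ 0 := fun h => hb0 (hι (h.trans (map_zero _).symm))
    refine ⟨g * h', h * g', ?_, ?_⟩
    · change ι (π (h * g')) ≠ 0
      rw [map_mul, ← hg', Ne, map_eq_zero_iff ι hι]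
      exact mul_ne_zero hu.ne_zero (mul_ne_zero hb0 hu'.ne_zero)
    · change _ * ι (π (h * g')) = ι (π (g * h'))
      rw [map_mul π, map_mul π, ← hg, ← hg', map_mul, map_mul, map_mul, map_mul]
      change algebraMap B Q a / algebraMap B Q b * (ι (π h) * (algebraMap B Q b * ι (π h'))) =
        algebraMap B Q a * ι (π h) * ι (π h')
      rw [mul_left_comm (ι (π h)), ← mul_assoc, div_mul_cancel₀ _ hbQ, mul_assoc]
  have hkerQ : RingHom.ker πQ = Ideal.span (Set.range f) := by
    rw [← hker]
    ext g
    simp only [RingHom.mem_ker]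
    exact map_eq_zero_iff ι hι
  have hJ : jacobiMatrix (πQ : MvPolynomial (Fin n) K →+* Q) f =
      (jacobiMatrix (π : MvPolynomial (Fin n) K →+* B) f).map (algebraMap B Q) := rfl
  have hΔQ : IsUnit (jacobiMinor (πQ : MvPolynomial (Fin n) K →+* Q) f i j) := by
    have h : jacobiMinor (πQ : MvPolynomial (Fin n) K →+* Q) f i j =
        algebraMap B Q (jacobiMinor (π : MvPolynomial (Fin n) K →+* B) f i j) := by
      rw [jacobiMinor, jacobiMinor, RingHom.map_det, hJ]
      rfl
    rw [h]
    exact hΔ.map _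
  have hcQ : jacobiMatrix (πQ : MvPolynomial (Fin n) K →+* Q) f = c.map (algebraMap B Q) *
      (jacobiMatrix (πQ : MvPolynomial (Fin n) K →+* Q) f).submatrix i id := by
    rw [hJ, Matrix.submatrix_map, ← Matrix.map_mul, ← hc]
  obtain ⟨σ, hσ0, hσK, hσX⟩ := exists_series_functionField πQ hgenQ hkerQ hΔQ hcQ ν
  have hcoeff : ∀ k g, coeff k (σ (πQ g)) ∈ (algebraMap B Q).range := by
    refine fun k g => coeff_mem_range (π : MvPolynomial (Fin n) K →+* B)
      (σ.comp (πQ : MvPolynomial (Fin n) K →+* Q)) (fun g => hσ0 _) (fun a => ?_) (f := f)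
      (fun a => ?_) hΔ (fun μ k => ?_) k g
    · have h : πQ (MvPolynomial.C a) = algebraMap K Q a := πQ.commutes a
      change σ (πQ (MvPolynomial.C a)) = C (πQ (MvPolynomial.C a))
      rw [h, hσK]
    · have h : f a ∈ RingHom.ker πQ := hkerQ ▸ Ideal.subset_span ⟨a, rfl⟩
      change σ (πQ (f a)) = 0
      rw [(RingHom.mem_ker).1 h, map_zero]
    · change coeff k (σ (πQ (MvPolynomial.X μ))) ∈ _
      rw [hσX, map_add, coeff_C]
      refine Subring.add_mem _ ?_ ?_
      · split_ifs
        exacts [⟨_, rfl⟩, Subring.zero_mem _]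
      · split_ifs
        · rw [coeff_X]
          split_ifs
          exacts [Subring.one_mem _, Subring.zero_mem _]
        · rw [map_zero]
          exact Subring.zero_mem _
  have hpoly : ∀ g, ∃ s : B⟦X⟧, PowerSeries.map (algebraMap B Q) s = σ (πQ g) := by
    intro g
    choose s hs using fun k => hcoeff k g
    exact ⟨PowerSeries.mk s, by ext k; simp [hs]⟩
  have hex : ∀ b, ∃ s : B⟦X⟧, PowerSeries.map (algebraMap B Q) s = σ (ι b) := by
    intro b
    obtain ⟨g, h, hu, hb⟩ := hgen b
    obtain ⟨s, hs⟩ := hpoly g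
    obtain ⟨t, ht⟩ := hpoly h
    -- The constant term of `t` is the unit `π h`, so dividing by the series of a denominator does
    -- not leave `B⟦X⟧`.
    have hunit : IsUnit t := by
      rw [isUnit_iff_constantCoeff]
      have h1 : algebraMap B Q (constantCoeff t) = algebraMap B Q (π h) := by
        rw [← hσ0 (algebraMap B Q (π h))]
        change _ = constantCoeff (σ (πQ h))
        rw [← ht, ← coeff_zero_eq_constantCoeff_apply, ← coeff_zero_eq_constantCoeff_apply,
          coeff_map]
      rw [hι h1]
      exact hu
    obtain ⟨u, hu'⟩ := hunit.exists_right_inv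
    refine ⟨s * u, ?_⟩
    have h2 : σ (πQ g) = σ (ι b) * σ (πQ h) := by
      rw [← map_mul]
      change σ (ι (π g)) = σ (ι b * ι (π h))
      rw [← map_mul, hb]
    rw [map_mul, hs, h2, ← ht, mul_assoc, ← map_mul, hu', map_one, mul_one]
  -- By injectivity of `B⟦X⟧ → Q⟦X⟧` the chosen series are unique, so `E` inherits the properties of
  -- `σ`.
  choose E hE using hex
  have hEadd : ∀ a b, E (a + b) = E a + E b := fun a b => hmap (by
    rw [map_add, hE, hE, hE, map_add, map_add])
  have hEmul : ∀ a b, E (a * b) = E a * E b := fun a b => hmap (by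
    rw [map_mul, hE, hE, hE, map_mul, map_mul])
  have hEK : ∀ a : K, E (algebraMap K B a) = C (algebraMap K B a) := fun a => hmap (by
    rw [hE, AlgHom.commutes, hσK, PowerSeries.map_C]
    rfl)
  have hE0 : ∀ b, coeff 0 (E b) = b := fun b => hι (by
    have h := hσ0 (ι b)
    rw [← hE, ← coeff_zero_eq_constantCoeff_apply, coeff_map] at h
    exact h)
  have hEX : ∀ μ : FreeIndex j, E (π (MvPolynomial.X μ)) =
      C (π (MvPolynomial.X μ)) + if ν = μ then X else 0 := fun μ => hmap (by
    have h := hσX μ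
    rw [hE]
    refine h.trans ?_
    rw [map_add, PowerSeries.map_C, apply_ite (PowerSeries.map (algebraMap B Q)), map_zero,
      PowerSeries.map_X]
    rfl)
  refine ⟨fun k =>
    { toFun := fun b => coeff k (E b)
      map_add' := fun a b => by rw [hEadd, map_add]
      map_smul' := fun a b => by
        rw [Algebra.smul_def, hEmul, hEK, coeff_C_mul, RingHom.id_apply, Algebra.smul_def] },
    ⟨⟨LinearMap.ext hE0, fun k a b => ?_⟩, fun μ => ?_, fun μ k hk => ?_⟩⟩
  · change coeff k (E (a * b)) = _
    rw [hEmul, coeff_mul]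
    rfl
  · change coeff 1 (E (π (MvPolynomial.X μ))) = _
    rw [hEX, map_add, coeff_C, if_neg one_ne_zero, zero_add]
    split_ifs <;> simp
  · change coeff k (E (π (MvPolynomial.X μ))) = 0
    rw [hEX, map_add, coeff_C, if_neg (by omega), zero_add]
    split_ifs
    · rw [coeff_X, if_neg (by omega)]
    · rw [map_zero]

end Existence

/-! ### Linear algebra of the Jacobi matrix and its minors -/

section Minors

/-- The rows `i` are independent, and there are as many of them as the rank, so they span the row
space. -/
theorem exists_eq_mul_submatrix_of_rank_eq {F : Type*} [Field F] {m n r : ℕ}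
    (J : Matrix (Fin m) (Fin n) F) (hr : J.rank = r) (i : Fin r → Fin m) (j : Fin r → Fin n)
    (hdet : (J.submatrix i j).det ≠ 0) :
    ∃ c : Matrix (Fin m) (Fin r) F, J = c * J.submatrix i id := by
  have hli : LinearIndependent F (J.submatrix i id).row := by
    have h := Matrix.linearIndependent_rows_of_det_ne_zero hdet
    exact LinearIndependent.of_comp (LinearMap.funLeft F F j) h
  have hle : Submodule.span F (Set.range (J.submatrix i id).row) ≤
      Submodule.span F (Set.range J.row) :=
    Submodule.span_mono (by rintro _ ⟨a, rfl⟩; exact ⟨i a, rfl⟩)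
  have heq := Submodule.eq_of_le_of_finrank_eq hle (by
    rw [finrank_span_eq_card hli, ← Matrix.rank_eq_finrank_span_row, hr, Fintype.card_fin])
  have hmem : ∀ a, ∃ c : Fin r → F, ∑ s, c s • (J.submatrix i id).row s = J.row a := fun a =>
    (Submodule.mem_span_range_iff_exists_fun F).1
      (heq ▸ Submodule.subset_span (Set.mem_range_self a))
  choose c hc using hmem
  refine ⟨Matrix.of c, Matrix.ext fun a b => ?_⟩
  have h := congrFun (hc a) b
  rw [Finset.sum_apply] at h
  exact h.symm

variable {K A : Type*} [CommRing K] [CommRing A] {m n r : ℕ}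
  {f : Fin m → MvPolynomial (Fin n) K} {i : Fin r ↪o Fin m} {j : Fin r ↪o Fin n}

theorem map_jacobiMinor {B : Type*} [CommRing B] (φ : MvPolynomial (Fin n) K →+* A) (ψ : A →+* B)
    (i : Fin r ↪o Fin m) (j : Fin r ↪o Fin n) :
    ψ (jacobiMinor φ f i j) = jacobiMinor (ψ.comp φ) f i j := by
  rw [jacobiMinor, RingHom.map_det]
  rfl

theorem jacobiMinor_eq_map (φ : MvPolynomial (Fin n) K →+* A) :
    jacobiMinor φ f i j = φ (jacobiMinor (RingHom.id _) f i j) := by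
  rw [map_jacobiMinor, RingHom.comp_id]

/-- If `i` and `j` are non-singular and `r` is the rank of the Jacobi matrix, then `Δ(i, j) ≠ 0`. -/
theorem jacobiMinor_ne_zero [IsDomain A] {φ : MvPolynomial (Fin n) K →+* A}
    (hr : ((jacobiMatrix φ f).map (algebraMap A (FractionRing A))).rank = r)
    (hi : NonsingularRows φ f i) (hj : NonsingularCols φ f j) : jacobiMinor φ f i j ≠ 0 := by
  have hinj := IsFractionRing.injective A (FractionRing A)
  obtain ⟨j', hj'⟩ := hi
  obtain ⟨i', hi'⟩ := hj
  set J := (jacobiMatrix φ f).map (algebraMap A (FractionRing A)) with hJ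
  have hdet : ∀ (i : Fin r ↪o Fin m) (j : Fin r ↪o Fin n),
      (J.submatrix i j).det = algebraMap A (FractionRing A) (jacobiMinor φ f i j) := by
    intro i j
    rw [jacobiMinor, RingHom.map_det]
    rfl
  obtain ⟨c, hc⟩ := exists_eq_mul_submatrix_of_rank_eq J hr i j' (by
    rw [hdet]
    exact (map_ne_zero_iff _ hinj).2 hj')
  intro h0
  have h1 : J.submatrix i' j = c.submatrix i' id * J.submatrix i j := by
    conv_lhs => rw [hc]
    rfl
  have h2 := hdet i' j
  rw [h1, Matrix.det_mul, hdet, h0, map_zero, mul_zero] at h2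
  exact hi' (hinj (h2.symm.trans (map_zero _).symm))

/-- Over the fraction field all rows are combinations of the rows `i`, and the columns `j` determine
the coefficients by Cramer's rule. Clearing the denominator `Δ` leaves an identity over `A`, which
can be mapped to `AΔ`. -/
theorem jacobiMinor_smul_jacobiMatrix [IsDomain A] {φ : MvPolynomial (Fin n) K →+* A}
    (hr : ((jacobiMatrix φ f).map (algebraMap A (FractionRing A))).rank = r)
    (hi : NonsingularRows φ f i) :
    jacobiMinor φ f i j • jacobiMatrix φ f = (jacobiMatrix φ f).submatrix id j *
      ((jacobiMatrix φ f).submatrix i j).adjugate * (jacobiMatrix φ f).submatrix i id := by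
  have hinj := IsFractionRing.injective A (FractionRing A)
  obtain ⟨j', hj'⟩ := hi
  set a := algebraMap A (FractionRing A)
  obtain ⟨c, hc⟩ := exists_eq_mul_submatrix_of_rank_eq ((jacobiMatrix φ f).map a) hr i j' (by
    have h : (((jacobiMatrix φ f).map a).submatrix i j').det = a (jacobiMinor φ f i j') := by
      rw [jacobiMinor, RingHom.map_det]
      rfl
    rw [h]
    exact (map_ne_zero_iff _ hinj).2 hj')
  refine Matrix.map_injective hinj ?_
  beta_reduce
  rw [Matrix.map_mul, Matrix.map_mul]
  have hadj : ((jacobiMatrix φ f).submatrix i j).adjugate.map a =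
      (((jacobiMatrix φ f).map a).submatrix i j).adjugate :=
    RingHom.map_adjugate a _
  have hcol : ((jacobiMatrix φ f).submatrix id j).map a =
      c * ((jacobiMatrix φ f).map a).submatrix i j := by
    conv_lhs => rw [← Matrix.submatrix_map, hc]
    rfl
  have hdet : (((jacobiMatrix φ f).map a).submatrix i j).det = a (jacobiMinor φ f i j) := by
    rw [jacobiMinor, RingHom.map_det]
    rfl
  rw [hadj, hcol, Matrix.mul_assoc c, Matrix.mul_adjugate, hdet, Matrix.mul_smul, Matrix.mul_one,
    Matrix.smul_mul, ← Matrix.submatrix_map, ← hc]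
  ext
  simp [a]

theorem exists_jacobiMatrix_eq_mul {φ : MvPolynomial (Fin n) K →+* A}
    (hΔ : IsUnit (jacobiMinor φ f i j))
    (h : jacobiMinor φ f i j • jacobiMatrix φ f = (jacobiMatrix φ f).submatrix id j *
      ((jacobiMatrix φ f).submatrix i j).adjugate * (jacobiMatrix φ f).submatrix i id) :
    ∃ c : Matrix (Fin m) (Fin r) A,
      jacobiMatrix φ f = c * (jacobiMatrix φ f).submatrix i id := by
  obtain ⟨u, hu⟩ := hΔ.exists_left_inv
  refine ⟨u • ((jacobiMatrix φ f).submatrix id j *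
    ((jacobiMatrix φ f).submatrix i j).adjugate), ?_⟩
  rw [Matrix.smul_mul, ← h, smul_smul, hu, one_smul]

theorem jacobiDerivation_X (φ : MvPolynomial (Fin n) K →+* A) (ν μ : FreeIndex j) :
    jacobiDerivation φ f i j ν (MvPolynomial.X μ) =
      jacobiMinor φ f i j * if ν = μ then 1 else 0 := by
  rw [jacobiDerivation, Matrix.det_succ_row _ (Fin.last r), Fin.sum_univ_castSucc,
    Finset.sum_eq_zero, zero_add]
  · simp only [Matrix.of_apply, Fin.snoc_last, Fin.succAbove_last, MvPolynomial.pderiv_X]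
    have h1 : (-1 : A) ^ ((Fin.last r : ℕ) + (Fin.last r : ℕ)) = 1 := Even.neg_one_pow ⟨_, rfl⟩
    rw [h1, one_mul, mul_comm]
    congr 1
    · rw [jacobiMinor]
      congr 1
      ext a b
      simp [jacobiMatrix]
    · by_cases h : ν = μ
      · subst h
        simp
      · rw [if_neg h, Pi.single_eq_of_ne (fun h' => h (Subtype.ext h'.symm)), map_zero]
  · intro s _
    have hs : (μ : Fin n) ≠ j s := fun h => μ.2 ⟨s, h.symm⟩
    simp [MvPolynomial.pderiv_X, Pi.single_eq_of_ne hs]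

variable [Algebra K A]

theorem jacobiMinor_mul_derivation (π : MvPolynomial (Fin n) K →ₐ[K] A) (hf : ∀ a, π (f a) = 0)
    (ν : FreeIndex j) (D : Derivation K A A)
    (hD : ∀ μ : FreeIndex j, D (π (MvPolynomial.X μ)) = if ν = μ then 1 else 0)
    (g : MvPolynomial (Fin n) K) :
    jacobiMinor (π : MvPolynomial (Fin n) K →+* A) f i j * D (π g) =
      jacobiDerivation (π : MvPolynomial (Fin n) K →+* A) f i j ν g := by
  classical
  have hchain : ∀ q, D (π q) = ∑ s, π (MvPolynomial.pderiv (j s) q) * D (π (MvPolynomial.X (j s)))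
      + π (MvPolynomial.pderiv (ν : Fin n) q) := by
    intro q
    rw [derivation_apply_eq_sum, sum_eq_sum_range_add_sum_freeIndex j]
    simp [hD]
  rw [jacobiDerivation]
  set M : Matrix (Fin (r + 1)) (Fin (r + 1)) A := Matrix.of fun a b : Fin (r + 1) =>
    (π : MvPolynomial (Fin n) K →+* A)
      (MvPolynomial.pderiv ((Fin.snoc j (ν : Fin n) : Fin (r + 1) → Fin n) b)
      ((Fin.snoc (fun a' : Fin r => f (i a')) g :
        Fin (r + 1) → MvPolynomial (Fin n) K) a)) with hM
  -- By the chain rule and `D (π (f a)) = 0`, the vector `M w` has the single nontrivial entry `D (π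
  -- g)`, the last one. Applying the adjugate and reading the last entry gives the claim.
  let w : Fin (r + 1) → A := Fin.snoc (fun s => D (π (MvPolynomial.X (j s)))) 1
  have hrow : ∀ a, M.mulVec w a = D (π ((Fin.snoc (fun a' : Fin r => f (i a')) g :
        Fin (r + 1) → MvPolynomial (Fin n) K) a)) := by
    intro a
    rw [hchain, Matrix.mulVec, dotProduct, Fin.sum_univ_castSucc]
    simp [hM, w]
  have hMw : M.mulVec w = Pi.single (Fin.last r) (D (π g)) := by
    ext a
    rw [hrow]
    refine Fin.lastCases ?_ (fun s => ?_) a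
    · simp
    · simp [hf]
  have h1 : M.adjugate.mulVec (M.mulVec w) (Fin.last r) = M.det := by
    rw [Matrix.mulVec_mulVec, Matrix.adjugate_mul, Matrix.smul_mulVec, Matrix.one_mulVec]
    simp [w]
  have h2 : M.adjugate (Fin.last r) (Fin.last r) =
      jacobiMinor (π : MvPolynomial (Fin n) K →+* A) f i j := by
    rw [Matrix.adjugate_fin_succ_eq_det_submatrix, Even.neg_one_pow ⟨_, rfl⟩, one_mul, jacobiMinor]
    congr 1
    ext a b
    simp [hM, jacobiMatrix]
  rw [← h1, hMw, Matrix.mulVec_single, ← h2]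
  simp

end Minors

/-! ### The determinantal normalization agrees with the values at the free coordinates -/

section Attached

variable {K B : Type*} [CommRing K] [CommRing B] [Algebra K B] {m n r : ℕ}
  {f : Fin m → MvPolynomial (Fin n) K} {i : Fin r ↪o Fin m} {j : Fin r ↪o Fin n}

theorem IsAttached.isPartial {φ : MvPolynomial (Fin n) K →+* B}
    (hΔ : IsUnit (jacobiMinor φ f i j)) {ν : FreeIndex j} {d : ℕ → Module.End K B}
    (hd : IsAttached φ f i j ν d) :
    IsPartial (fun μ : FreeIndex j => φ (MvPolynomial.X μ)) ν d where
  toIsHigherDerivation := hd.iterative.toIsHigherDerivation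
  first μ := by
    have h := hd.first (MvPolynomial.X μ)
    rw [jacobiDerivation_X] at h
    exact hΔ.mul_left_cancel h
  higher := hd.higher

theorem IsPartial.isAttached (π : MvPolynomial (Fin n) K →ₐ[K] B) (hf : ∀ a, π (f a) = 0)
    (hx : ∀ D : Derivation K B B, (∀ ν : FreeIndex j, D (π (MvPolynomial.X ν)) = 0) → D = 0)
    {ν : FreeIndex j} {d : ℕ → Module.End K B}
    (hd : IsPartial (fun μ : FreeIndex j => π (MvPolynomial.X μ)) ν d) :
    IsAttached (π : MvPolynomial (Fin n) K →+* B) f i j ν d where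
  iterative := by
    classical
    exact hd.isIterative hx
  first g := by
    let D : Derivation K B B := Derivation.mk' (d 1) (fun a b => by
      rw [hd.leibniz, Finset.Nat.antidiagonal_succ]
      simp [hd.zero, mul_comm])
    exact jacobiMinor_mul_derivation π hf ν D hd.first g
  higher := hd.higher

theorem subalgebra_eq_top (π : MvPolynomial (Fin n) K →ₐ[K] B)
    (hgen : ∀ b, ∃ g h, IsUnit (π h) ∧ b * π h = π g) (j : Fin r ↪o Fin n) (W : Subalgebra K B)
    (hfree : ∀ ν : FreeIndex j, π (MvPolynomial.X ν) ∈ W)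
    (hdep : ∀ s, π (MvPolynomial.X (j s)) ∈ W) (hinv : ∀ a b, a * b = 1 → a ∈ W → b ∈ W) :
    W = ⊤ := by
  have hpoly : ∀ g, π g ∈ W := by
    intro g
    induction g using MvPolynomial.induction_on with
    | C c =>
      have h : π (MvPolynomial.C c) = algebraMap K B c := π.commutes c
      exact h ▸ W.algebraMap_mem c
    | add p q hp hq => exact map_add π p q ▸ W.add_mem hp hq
    | mul_X p l hp =>
      rw [map_mul]
      refine W.mul_mem hp ?_
      by_cases hl : l ∈ Set.range j
      · obtain ⟨s, rfl⟩ := hl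
        exact hdep s
      · exact hfree ⟨l, hl⟩
  refine eq_top_iff.2 fun b _ => ?_
  obtain ⟨g, h, hu, hb⟩ := hgen b
  obtain ⟨u, hu'⟩ := hu.exists_right_inv
  have h1 : b = π g * u := by rw [← hb, mul_assoc, hu', mul_one]
  exact h1 ▸ W.mul_mem (hpoly g) (hinv _ _ hu' (hpoly h))

end Attached

/-! ### Kernel and denominators of the map from the polynomial ring -/

section Localization

variable {K : Type*} [Field K] {n : ℕ} {I : Ideal (MvPolynomial (Fin n) K)}

/-- As `A` is nonzero, `0 ∉ S`; so `S` consists of nonzerodivisors of the domain `P_n / I`. -/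
theorem ker_coordHom (hprime : I.IsPrime) (S : Submonoid (MvPolynomial (Fin n) K ⧸ I))
    (A : Type*) [CommRing A] [Nontrivial A] [Algebra (MvPolynomial (Fin n) K ⧸ I) A]
    [IsLocalization S A] (g : MvPolynomial (Fin n) K) : coordHom I A g = 0 ↔ g ∈ I := by
  have h0 : (0 : MvPolynomial (Fin n) K ⧸ I) ∉ S := fun h =>
    not_subsingleton A (IsLocalization.subsingleton h)
  have hinj : Function.Injective (algebraMap (MvPolynomial (Fin n) K ⧸ I) A) :=
    IsLocalization.injective A (le_nonZeroDivisors_of_noZeroDivisors h0)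
  rw [coordHom, RingHom.comp_apply, map_eq_zero_iff _ hinj, Ideal.Quotient.eq_zero_iff_mem]

theorem exists_mul_eq_of_isLocalization (S : Submonoid (MvPolynomial (Fin n) K ⧸ I))
    {A : Type*} [CommRing A] [Algebra (MvPolynomial (Fin n) K ⧸ I) A] [IsLocalization S A]
    (D : MvPolynomial (Fin n) K) {B : Type*} [CommRing B] [Algebra A B]
    [IsLocalization.Away (coordHom I A D) B] (b : B) :
    ∃ g h : MvPolynomial (Fin n) K, IsUnit (algebraMap A B (coordHom I A h)) ∧
      b * algebraMap A B (coordHom I A h) = algebraMap A B (coordHom I A g) := by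
  obtain ⟨⟨a, ⟨_, k, rfl⟩⟩, hb⟩ := IsLocalization.surj (Submonoid.powers (coordHom I A D)) b
  obtain ⟨⟨z, s⟩, ha⟩ := IsLocalization.surj S a
  obtain ⟨g, rfl⟩ := Ideal.Quotient.mk_surjective z
  obtain ⟨h, hh⟩ := Ideal.Quotient.mk_surjective (s : MvPolynomial (Fin n) K ⧸ I)
  have hA : coordHom I A h = algebraMap _ A (s : MvPolynomial (Fin n) K ⧸ I) := by
    rw [← hh]
    rfl
  have ha' : a * coordHom I A h = coordHom I A g := by
    rw [hA]
    exact ha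
  refine ⟨g, h * D ^ k, ?_, ?_⟩
  · rw [map_mul, map_mul, map_pow, map_pow]
    refine IsUnit.mul ?_ (IsUnit.pow _ (IsLocalization.Away.algebraMap_isUnit _))
    rw [hA]
    exact (IsLocalization.map_units A s).map _
  · simp only at hb
    rw [← ha', map_mul, map_mul, map_mul, ← hb, map_pow]
    ring

end Localization

end DiffOps



/-! ### The theorem -/

theorem theorem2p7 {K : Type*} [Field K] (p : ℕ) [Fact p.Prime] [CharP K p] [PerfectField K]
    {m n r : ℕ} (f : Fin m → MvPolynomial (Fin n) K)
    (I : Ideal (MvPolynomial (Fin n) K)) (hf : Ideal.span (Set.range f) = I)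
    (hprime : I.IsPrime) (hmax : ¬ I.IsMaximal)
    (S : Submonoid (MvPolynomial (Fin n) K ⧸ I))
    -- `A` is the localization of `P_n / I` at `S`, a domain
    {A : Type*} [CommRing A] [IsDomain A] [Algebra K A]
    [Algebra (MvPolynomial (Fin n) K ⧸ I) A] [IsScalarTower K (MvPolynomial (Fin n) K ⧸ I) A]
    [IsLocalization S A]
    -- `r` is the rank of the Jacobi matrix over the field of fractions of `A`
    (hr : ((jacobiMatrix (coordHom I A) f).map (algebraMap A (FractionRing A))).rank = r)
    (i : Fin r ↪o Fin m) (hi : NonsingularRows (coordHom I A) f i)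
    (j : Fin r ↪o Fin n) (hj : NonsingularCols (coordHom I A) f j)
    -- `AΔ` is the localization of `A` at the powers of `Δ(i, j)`
    {AΔ : Type*} [CommRing AΔ] [Algebra K AΔ] [Algebra A AΔ] [IsScalarTower K A AΔ]
    [IsLocalization.Away (jacobiMinor (coordHom I A) f i j) AΔ]
    (π : MvPolynomial (Fin n) K →+* AΔ) (hπ : π = (algebraMap A AΔ).comp (coordHom I A)) :
    -- the higher derivations `δ_ν` exist and are unique
    (∀ ν : FreeIndex j, ∃! d : ℕ → Module.End K AΔ, IsAttached π f i j ν d) ∧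
    ∀ δ : FreeIndex j → ℕ → Module.End K AΔ, (∀ ν, IsAttached π f i j ν (δ ν)) →
      -- generators of `D(AΔ)`
      Algebra.adjoin K (Set.range (Algebra.lmul K AΔ) ∪
        Set.range (fun q : FreeIndex j × ℕ => δ q.1 q.2)) = diffOps K AΔ ∧
      -- the relations are defining relations
      (∃ e : Presented (fun ν : FreeIndex j => π (MvPolynomial.X ν))
            (fun s : Fin r => π (MvPolynomial.X (j s))) δ ≃ₐ[K] diffOps K AΔ,
        (∀ a : AΔ, (e (RingQuot.mkAlgHom K _ (coeffGen K (FreeIndex j) a)) : Module.End K AΔ) =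
          Algebra.lmul K AΔ a) ∧
        ∀ (ν : FreeIndex j) (k : ℕ),
          (e (RingQuot.mkAlgHom K _ (deltaGen K AΔ ν k)) : Module.End K AΔ) = δ ν k) ∧
      -- the coefficients in the last relation are the divided powers of the first term
      ∀ (ν : FreeIndex j) (s : Fin r) (t : ℕ),
        t.factorial • δ ν t (π (MvPolynomial.X (j s))) =
          (δ ν 1 ^ t) (π (MvPolynomial.X (j s))) := by
  classical
  set Δ := jacobiMinor (coordHom I A) f i j with hΔdef
  have hΔ0 : Δ ≠ 0 := jacobiMinor_ne_zero hr hi hj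
  have hpow : Submonoid.powers Δ ≤ nonZeroDivisors A :=
    powers_le_nonZeroDivisors_of_noZeroDivisors hΔ0
  have : IsDomain AΔ := IsLocalization.isDomain_of_le_nonZeroDivisors AΔ hpow
  have hinj : Function.Injective (algebraMap A AΔ) := IsLocalization.injective AΔ hpow
  obtain ⟨π, rfl⟩ : ∃ π' : MvPolynomial (Fin n) K →ₐ[K] AΔ,
      (π' : MvPolynomial (Fin n) K →+* AΔ) = π :=
    ⟨{ π with
        commutes' := fun c => by
          change π (algebraMap K _ c) = _
          rw [hπ, IsScalarTower.algebraMap_apply K A AΔ,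
            IsScalarTower.algebraMap_apply K (MvPolynomial (Fin n) K ⧸ I) A]
          rfl }, rfl⟩
  have hπ' : ∀ g, π g = algebraMap A AΔ (coordHom I A g) := DFunLike.congr_fun hπ
  have hker : RingHom.ker π = Ideal.span (Set.range f) := by
    ext g
    rw [RingHom.mem_ker, hπ', map_eq_zero_iff _ hinj, ker_coordHom hprime S, hf]
  have hf0 : ∀ a, π (f a) = 0 := fun a => by
    have h : f a ∈ RingHom.ker π := hker ▸ Ideal.subset_span ⟨a, rfl⟩
    exact h
  have hgen : ∀ b, ∃ g h, IsUnit (π h) ∧ b * π h = π g := by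
    -- `Δ` is the image of a polynomial, so its powers also serve as polynomial denominators.
    have hD : Δ = coordHom I A (jacobiMinor (RingHom.id _) f i j) := jacobiMinor_eq_map _
    have : IsLocalization.Away (coordHom I A (jacobiMinor (RingHom.id _) f i j)) AΔ :=
      hD ▸ ‹IsLocalization.Away Δ AΔ›
    intro b
    simpa only [hπ'] using
      exists_mul_eq_of_isLocalization S (jacobiMinor (RingHom.id _) f i j) b
  have hΔ : IsUnit (jacobiMinor (π : MvPolynomial (Fin n) K →+* AΔ) f i j) := by
    rw [hπ, ← map_jacobiMinor]
    exact IsLocalization.Away.algebraMap_isUnit Δ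
  obtain ⟨c, hc⟩ := exists_jacobiMatrix_eq_mul hΔ (by
    have h := congrArg (fun M => M.map (algebraMap A AΔ))
      (jacobiMinor_smul_jacobiMatrix (j := j) hr hi)
    simp only [Matrix.map_mul] at h
    have hJ : jacobiMatrix (π : MvPolynomial (Fin n) K →+* AΔ) f =
        (jacobiMatrix (coordHom I A) f).map (algebraMap A AΔ) := by
      rw [hπ]
      rfl
    have hadj : ((jacobiMatrix (coordHom I A) f).submatrix i j).adjugate.map (algebraMap A AΔ) =
        (((jacobiMatrix (coordHom I A) f).map (algebraMap A AΔ)).submatrix i j).adjugate :=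
      RingHom.map_adjugate (algebraMap A AΔ) _
    rw [hadj] at h
    rw [hJ]
    refine Eq.trans ?_ h
    rw [hπ, ← map_jacobiMinor]
    ext
    simp)
  have hx : ∀ D : Derivation K AΔ AΔ,
      (∀ ν : FreeIndex j, D (π (MvPolynomial.X ν)) = 0) → D = 0 :=
    derivation_eq_zero π hgen hf0 hΔ
  refine ⟨fun ν => ?_, fun δ hδ => ?_⟩
  · obtain ⟨d, hd⟩ := exists_isPartial π hgen hker hΔ hc ν
    exact ⟨d, hd.isAttached π hf0 hx, fun d' hd' => (hd'.isPartial hΔ).unique hx hd⟩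
  · have hδ' : ∀ ν, IsPartial (fun μ : FreeIndex j => π (MvPolynomial.X μ)) ν (δ ν) :=
      fun ν => (hδ ν).isPartial hΔ
    refine ⟨adjoin_eq_diffOps hx hδ', ?_, fun ν s t => ?_⟩
    · exact exists_presented_equiv hx hδ' fun W => subalgebra_eq_top π hgen j W
    · rw [(hδ ν).iterative.first_pow]
      rfl
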